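/- Setting. Let $G$ be a compact Lie group (e.g. $SU(2)$) with a bi-invariant Riemannian metric, normalized Haar measure and Lie algebra $\mathfrak g$, and let $\kappa,m,\lambda\in\mathbb R$. Fields are smooth functions $\phi^c:M\to\mathbb C$, with $M=G^{\times n}$; write $\phi_{1,2,3}=\phi(g_1,g_2,g_3)$, etc. All models have the local Lagrangian $L^L=\sum_c(\kappa\nabla\bar\phi^c\cdot\nabla\phi^c+m\bar\phi^c\phi^c)$ and the action $S=\int_M L^L+S^I$. The fields are either all smooth functions or only the gauge-invariant ones, $\phi^c(g_1h,\dots,g_nh)=\phi^c(g_1,\dots,g_n)$ for all $h\in G$; "on shell" means that $S$ is stationary at $\phi$ with respect to all variations in the chosen space of fields. A one-parameter group of transformations acts by a flow $C_t$ on $M$ with generator $X_M$ and by phases $\phi^c\mapsto e^{it\theta_c}\phi^c$; put $X_Q^c=\frac{d}{dt}\big|_0e^{it\theta_c}\phi^c\circ C_{-t}=i\theta_c\phi^c-X_M(\phi^c)$, where $X_M(\phi)$ is the Lie derivative. The Noether current of the local part is the vector field $$J=\kappa\sum_c\left(\nabla\phi^c\,\bar X^c_Q+\nabla\bar\phi^c\,X^c_Q\right)+L^L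 X_M .$$ For a factor of an interaction monomial, $\phi\int\phi\cdots\phi$ denotes $\phi$ at the point $x\in M$ times the integral of the other factors, in which the variables shared with the omitted factor are set to the components of $x$ and the remaining ones are integrated over. If no factor is named, the first one is omitted. "Left multiplication by $C$" means that $C_t$ multiplies the arguments from the left by one-parameter subgroups arranged in the pattern $C$. Theorem. On shell the current satisfies, pointwise on $M$, $\mathrm{Div}(J)=\Delta$ (in place of a conservation law) with the following correction terms. 1. $S^I=\lambda\int\phi^1_{1,2,3}\phi^2_{1,4,5}\phi^3_{6,2,5}\phi^4_{6,4,3}+c.c.$: for left multiplication by $(c^1,c^2,c^3)$, $\Delta=-2\lambda\sum_c\Re\left(X_M(\phi^c)\int\prod_{c'\ne c}\phi^{c'}\right)$; for $\phi^c\mapsto e^{i\theta_c}\phi^c$ with $\sum_c\theta_c=0$, $\Delta=-2\lambda\sum_c\theta_c\,\Im\left(\phi^c\int\prod_{c'\neq c}\phi^{c'}\right)$. 2. $S^I=\lambda\int\phi_{1,2,3}\phi_{3,4,5}\phi_{5,2,6}\phi_{6,4,1}+c.c.$: for left multiplication by $(c^1,c^2,c^1)$, $\Delta=-8\lambda\,\Re\left(X_M(\phi)\int\phi\phi\phi\right)$.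 3. Fields (and variations) that are in addition invariant under cyclic permutations of their three arguments, $S^I=\lambda\int\phi_{1,2,3}\phi_{1,4,5}\phi_{2,5,6}\phi_{3,6,4}+c.c.$: for left multiplication by $(c,c,c)$, $\Delta=-8\lambda\,\Re\left(X_M(\phi)\int\phi\phi\phi\right)$. For the variant $\phi_{1,2,3}\phi_{4,3,5}\phi_{5,2,6}\phi_{6,4,1}$, the same holds with $4\int\phi\phi\phi$ replaced by the sum of the four integrals in which one factor is omitted, averaged over the cyclic permutations of the arguments $(x_1,x_2,x_3)$. 4. $S^I=\lambda\int\phi_{1,2,3}\bar\phi_{3,4,5}\phi_{5,2,6}\bar\phi_{6,4,1}$: for left multiplication by $(c^1,c^2,c^1)$, $\Delta=-4\lambda\,\Re\left(X_M(\phi)\int\bar\phi\phi\bar\phi\right)$; for $\phi\mapsto e^{i\theta}\phi$, $\Delta=-4\lambda\theta\,\Im\left(\phi\int\bar\phi\phi\bar\phi\right)$. 5. $n=4$, $S^I=\lambda\int\phi_{1,2,3,4}\phi_{4,5,6,7}\phi_{7,3,8,9}\phi_{9,6,2,10}\phi_{10,8,5,1}+c.c.$: for left multiplication by $(c^1,c^2,c^2,c^1)$,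 $\Delta=-10\lambda\,\Re\left(X_M(\phi)\int\phi\phi\phi\phi\right)$. 6. Barrett–Crane model: $G=SU(2)$, $M=Spin(4)^{\times4}\times SU(2)$ with $Spin(4)=SU(2)_-\times SU(2)_+$, fields $\phi(\vec g;k)$ invariant under $(g^j_-,g^j_+;k)\mapsto(g_-^jku^jk^{-1}h_-,\,g_+^ju^jh_+;\,h_-^{-1}kh_+)$ for all $u^j,h_\pm\in SU(2)$, and $S^I=\lambda\int\phi_{1,2,3,4,k_1}\phi_{4,5,6,7,k_2}\phi_{7,3,8,9,k_3}\phi_{9,6,2,10,k_4}\phi_{10,8,5,1,k_5}+c.c.$ Both for left multiplication of $\vec g$ by $(s^1,s^2,s^2,s^1)$, $s^i\in Spin(4)$, and for simultaneous conjugation of all $g^j_\pm$ and $k$ by $c\in SU(2)$: if $S$ is stationary at $\phi$ under all smooth variations, then $\Delta=-10\lambda\,\Re\left(X_M(\phi)\int\phi\phi\phi\phi\right)$; if it is stationary under the variations that obey the constraints, then the same holds with $\int\phi\phi\phi\phi$ averaged over $u\in SU(2)^{\times4}$ (with $h_\pm=1$). Here the kinetic term may have coupling $\kappa$ along $Spin(4)^{\times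 4}$ and $\kappa'$ along the normal $k$, with $\kappa'=0$ in the second case. (The static model is $\kappa=\kappa'=0$.) 7. For static models, $\kappa=0$, the current $J$ of the $U(1)$ symmetries in 1 and 4 vanishes identically. -/

import Mathlib

open MeasureTheory Finset
open scoped ContDiff ComplexConjugate

noncomputable section

namespace GFT

/-! ## Compact Lie groups

A compact Lie group is given as a compact topological group `G` with a faithful continuous
finite-dimensional matrix representation `ρ` (by the Peter–Weyl theorem every compact Lie group
is of this form; for `SU(2)` take the inclusion into the 2 by 2 matrices). Then `ρ` identifies `G`
with a closed embedded submanifold of the space of matrices. -/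

variable {G : Type*} [Group G] {N : ℕ}

/-- Smooth one-parameter subgroups of `G`. -/
structure OneParam (ρ : G →* Matrix (Fin N) (Fin N) ℂ) where
  toFun : ℝ → G
  map_add : ∀ s t, toFun (s + t) = toFun s * toFun t
  smooth : ∀ i j, ContDiff ℝ ∞ (fun t => ρ (toFun t) i j)

instance (ρ : G →* Matrix (Fin N) (Fin N) ℂ) : CoeFun (OneParam ρ) (fun _ => ℝ → G) :=
  ⟨OneParam.toFun⟩

/-- The trivial one-parameter subgroup. -/
def OneParam.trivial (ρ : G →* Matrix (Fin N) (Fin N) ℂ) : OneParam ρ where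
  toFun _ := 1
  map_add _ _ := (one_mul 1).symm
  smooth _ _ := contDiff_const

/-- The velocity at `0` of a curve in `G`, as a matrix. -/
def velocity (ρ : G →* Matrix (Fin N) (Fin N) ℂ) (c : ℝ → G) : Matrix (Fin N) (Fin N) ℂ :=
  Matrix.of fun i j => deriv (fun t => ρ (c t) i j) 0

/-- A bi-invariant Riemannian metric on `G`: an inner product `B` on the Lie algebra (the set of
velocities of one-parameter subgroups) that is invariant under the adjoint action of `G`, together
with an orthonormal basis of the Lie algebra. The basis elements are given by one-parameter
subgroups `e a`. Symmetry and positivity of `B` on the Lie algebra follow from orthonormality. -/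
structure InvariantMetric (ρ : G →* Matrix (Fin N) (Fin N) ℂ) (d : ℕ) where
  B : Matrix (Fin N) (Fin N) ℂ →ₗ[ℝ] Matrix (Fin N) (Fin N) ℂ →ₗ[ℝ] ℝ
  e : Fin d → OneParam ρ
  ad_invariant : ∀ (g : G) (γ δ : OneParam ρ),
    B (ρ g * velocity ρ γ * ρ g⁻¹) (ρ g * velocity ρ δ * ρ g⁻¹) =
      B (velocity ρ γ) (velocity ρ δ)
  orthonormal : ∀ a b, B (velocity ρ (e a)) (velocity ρ (e b)) = if a = b then 1 else 0
  spanning : ∀ γ : OneParam ρ,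
    velocity ρ γ ∈ Submodule.span ℝ (Set.range fun a => velocity ρ (e a))

/-! ## Calculus on the base manifold `M = ι → G`, a product of copies of `G` -/

section Calculus

variable {ι : Type*} [Fintype ι] [DecidableEq ι]
variable {ρ : G →* Matrix (Fin N) (Fin N) ℂ} {d : ℕ}

/-- Smooth functions on the closed embedded submanifold `M` of a space of tuples of matrices:
restrictions of smooth functions on the ambient space. -/
def IsSmooth (ρ : G →* Matrix (Fin N) (Fin N) ℂ) (u : (ι → G) → ℂ) : Prop :=
  ∃ F : (ι → Fin N → Fin N → ℂ) → ℂ, ContDiff ℝ ∞ F ∧ ∀ x, u x = F fun A i j => ρ (x A) i j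

/-- Derivative of `u` along the left-invariant vector field `E_(A,a)`, which is generated by
right translation of the `A`-th copy of `G` by the one-parameter subgroup `e a`. The fields
`E_(A,a)` form an orthonormal frame of `M` (product metric). -/
def frameDeriv (Q : InvariantMetric ρ d) (A : ι) (a : Fin d) (u : (ι → G) → ℂ) (x : ι → G) : ℂ :=
  deriv (fun t : ℝ => u (Function.update x A (x A * Q.e a t))) 0

/-- Divergence of the vector field `∑ J^(A,a) E_(A,a)`. The left-invariant fields `E_(A,a)` of a
compact group are divergence-free, so it is `∑ E_(A,a) (J^(A,a))`. -/
def divergence (Q : InvariantMetric ρ d) (J : ι → Fin d → (ι → G) → ℂ) (x : ι → G) : ℂ :=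
  ∑ A, ∑ a, frameDeriv Q A a (J A a) x

/-- The Lie derivative `X_M(u)`, where `X_M` is the generator of the flow `Φ` on `M`. -/
def lieDeriv (Φ : ℝ → (ι → G) → (ι → G)) (u : (ι → G) → ℂ) (x : ι → G) : ℂ :=
  deriv (fun t => u (Φ t x)) 0

/-- The `(A,a)`-component, in the frame `E_(A,a)`, of the generator `X_M` of the flow `Φ`. -/
def generatorComponent (Q : InvariantMetric ρ d) (Φ : ℝ → (ι → G) → (ι → G))
    (A : ι) (a : Fin d) (x : ι → G) : ℝ :=
  Q.B (velocity ρ fun t => (x A)⁻¹ * Φ t x A) (velocity ρ (Q.e a))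

/-- The flow of left multiplications by one-parameter subgroups. -/
def leftFlow (γ : ι → OneParam ρ) (t : ℝ) (x : ι → G) : ι → G := fun A => γ A t * x A

/-- The flow of conjugations by a one-parameter subgroup, in all copies simultaneously. -/
def conjFlow (γ : OneParam ρ) (t : ℝ) (x : ι → G) : ι → G := fun A => γ t * x A * (γ t)⁻¹

/-- The trivial flow: its generator is `X_M = 0`. -/
def trivialFlow (_ : ℝ) (x : ι → G) : ι → G := x

end Calculus

/-! ## Fields, local Lagrangian and Noether current

A field configuration is `φ : C → (ι → G) → ℂ`, where `C` is the set of colors. -/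

section Fields

variable {ι : Type*} [Fintype ι] [DecidableEq ι] {C : Type*} [Fintype C]
variable {ρ : G →* Matrix (Fin N) (Fin N) ℂ} {d : ℕ}

/-- Smooth configurations, all components of which are invariant under the maps in `𝒯`. -/
def fields (ρ : G →* Matrix (Fin N) (Fin N) ℂ) (C : Type*) (𝒯 : Set ((ι → G) → (ι → G))) :
    Set (C → (ι → G) → ℂ) :=
  {φ | ∀ c, IsSmooth ρ (φ c) ∧ ∀ T ∈ 𝒯, φ c ∘ T = φ c}

/-- The gauge transformations: right multiplications by the diagonal subgroup. -/
def gaugeMaps (G : Type*) [Group G] (ι : Type*) : Set ((ι → G) → (ι → G)) :=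
  {T | ∃ h : G, T = fun x A => x A * h}

/-- `φ` is a stationary point of `S` with respect to variations in the directions `η ∈ 𝓥`. -/
def IsStationary (S : (C → (ι → G) → ℂ) → ℂ) (𝓥 : Set (C → (ι → G) → ℂ))
    (φ : C → (ι → G) → ℂ) : Prop :=
  ∀ η ∈ 𝓥, HasDerivAt (fun s : ℝ => S fun c x => φ c x + (s : ℂ) * η c x) 0 0

/-- The local Lagrangian `L^L = ∑_c (κ ∇φ̄^c · ∇φ^c + m φ̄^c φ^c)`. The coupling `κ A` is allowed to
depend on the copy `A` of `G`. -/
def localLagrangian (Q : InvariantMetric ρ d) (κ : ι → ℝ) (m : ℝ) (φ : C → (ι → G) → ℂ)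
    (x : ι → G) : ℂ :=
  ∑ c, ((∑ A, (κ A : ℂ) * ∑ a,
      frameDeriv Q A a (fun y => conj (φ c y)) x * frameDeriv Q A a (φ c) x)
    + (m : ℂ) * (conj (φ c x) * φ c x))

/-- The characteristic `X_Q^c = d/dt|₀ Q_t ∘ φ^c ∘ Φ_t⁻¹` of the one-parameter group of
transformations that acts on `M` by the flow `Φ` and on the fields by the phases `exp (i t θ_c)`. -/
def characteristic (Φ : ℝ → (ι → G) → (ι → G)) (θ : C → ℝ) (φ : C → (ι → G) → ℂ)
    (c : C) (x : ι → G) : ℂ :=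
  deriv (fun t : ℝ => Complex.exp (Complex.I * t * θ c) * φ c (Φ (-t) x)) 0

/-- The Noether current of the local part,
`J = κ ∑_c (∇φ^c X̄_Q^c + ∇φ̄^c X_Q^c) + L^L X_M`, by its components in the frame `E_(A,a)`. -/
def current (Q : InvariantMetric ρ d) (κ : ι → ℝ) (m : ℝ) (φ : C → (ι → G) → ℂ)
    (Φ : ℝ → (ι → G) → (ι → G)) (θ : C → ℝ) (A : ι) (a : Fin d) (x : ι → G) : ℂ :=
  (κ A : ℂ) * ∑ c, (frameDeriv Q A a (φ c) x * conj (characteristic Φ θ φ c x)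
      + frameDeriv Q A a (fun y => conj (φ c y)) x * characteristic Φ θ φ c x)
    + localLagrangian Q κ m φ x * (generatorComponent Q Φ A a x : ℂ)

end Fields

/-! ## Non-local interactions

The combinatorics of an interaction is given by `f : V → ι → ε`: the `i`-th argument of the `v`-th
factor is the variable `g (f v i)`. -/

section Interaction

variable [MeasurableSpace G] {ι V ε C : Type*} [Fintype ι] [DecidableEq ι] [Fintype V]
  [DecidableEq V] [Fintype ε] [Fintype C]
variable {ρ : G →* Matrix (Fin N) (Fin N) ℂ} {d : ℕ}

/-- `∫ ∏_v ψ_v (g_(f v 1), …, g_(f v n))`, integrated over all variables. -/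
def interaction (μ : Measure G) (f : V → ι → ε) (ψ : V → (ι → G) → ℂ) : ℂ :=
  ∫ g : ε → G, ∏ v, ψ v (g ∘ f v) ∂Measure.pi fun _ => μ

/-- The integral `∫ ∏_(w ≠ v) ψ_w` as a function of the arguments `x` of the omitted factor `v`:
the variables that occur in factor `v` are set to `x`, the others are integrated out. (`μ` is a
probability measure, so integrating over the unused variables has no effect.) -/
def omitIntegral (μ : Measure G) (f : V → ι → ε) (ψ : V → (ι → G) → ℂ) (v : V) (x : ι → G) : ℂ :=
  ∫ g : ε → G, ∏ w ∈ univ.erase v, ψ w (Function.extend (f v) x g ∘ f w) ∂Measure.pi fun _ => μ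

/-- The local action `∫_M L^L`. -/
def localAction (μ : Measure G) (Q : InvariantMetric ρ d) (κ : ι → ℝ) (m : ℝ)
    (φ : C → (ι → G) → ℂ) : ℂ :=
  ∫ x : ι → G, localLagrangian Q κ m φ x ∂Measure.pi fun _ => μ

/-- The action `∫_M L^L + (λ ∫ ∏_v φ^(col v) + c.c.)`; `col v` is the color of the factor `v`. -/
def action (μ : Measure G) (Q : InvariantMetric ρ d) (κ : ι → ℝ) (m l : ℝ)
    (f : V → ι → ε) (col : V → C) (φ : C → (ι → G) → ℂ) : ℂ :=
  localAction μ Q κ m φ + ((l : ℂ) * interaction μ f (fun v => φ (col v))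
    + conj ((l : ℂ) * interaction μ f (fun v => φ (col v))))

/-- The four factors `φ φ̄ φ φ̄`. -/
def alternating (φ : (ι → G) → ℂ) : Fin 4 → (ι → G) → ℂ :=
  ![φ, fun x => conj (φ x), φ, fun x => conj (φ x)]

/-- The action `∫_M L^L + λ ∫ φ φ̄ φ φ̄` of a single field. -/
def alternatingAction (μ : Measure G) (Q : InvariantMetric ρ d) (κ : ι → ℝ) (m l : ℝ)
    (f : Fin 4 → ι → ε) (φ : Unit → (ι → G) → ℂ) : ℂ :=
  localAction μ Q κ m φ + (l : ℂ) * interaction μ f (alternating (φ ()))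

end Interaction

/-! ## The combinatorics of the models (variables are numbered from 0) -/

/-- `φ¹_{1,2,3} φ²_{1,4,5} φ³_{6,2,5} φ⁴_{6,4,3}` -/
def coloredPattern : Fin 4 → Fin 3 → Fin 6 :=
  ![![0, 1, 2], ![0, 3, 4], ![5, 1, 4], ![5, 3, 2]]

/-- `φ_{1,2,3} φ_{3,4,5} φ_{5,2,6} φ_{6,4,1}` -/
def simplicialPattern : Fin 4 → Fin 3 → Fin 6 :=
  ![![0, 1, 2], ![2, 3, 4], ![4, 1, 5], ![5, 3, 0]]

/-- `φ_{1,2,3} φ_{1,4,5} φ_{2,5,6} φ_{3,6,4}` (original Boulatov interaction) -/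
def boulatovPattern : Fin 4 → Fin 3 → Fin 6 :=
  ![![0, 1, 2], ![0, 3, 4], ![1, 4, 5], ![2, 5, 3]]

/-- `φ_{1,2,3} φ_{4,3,5} φ_{5,2,6} φ_{6,4,1}` -/
def boulatovPattern' : Fin 4 → Fin 3 → Fin 6 :=
  ![![0, 1, 2], ![3, 2, 4], ![4, 1, 5], ![5, 3, 0]]

/-- `φ_{1,2,3,4} φ_{4,5,6,7} φ_{7,3,8,9} φ_{9,6,2,10} φ_{10,8,5,1}` -/
def ooguriPattern : Fin 5 → Fin 4 → Fin 10 :=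
  ![![0, 1, 2, 3], ![3, 4, 5, 6], ![6, 2, 7, 8], ![8, 5, 1, 9], ![9, 7, 4, 0]]

/-- Cyclic permutations of the three arguments of a field. -/
def cyclicMaps (G : Type*) : Set ((Fin 3 → G) → (Fin 3 → G)) :=
  {T | ∃ r : Fin 3, T = fun x i => x (i + r)}

/-- The slots of `Spin(4)^4 × SU(2)`, where `Spin(4) = SU(2)_- × SU(2)_+`: the slot
`inl (j, false)` holds `g^j_-`, the slot `inl (j, true)` holds `g^j_+`, and `inr ()` holds `k`. -/
abbrev BCSlot := (Fin 4 × Bool) ⊕ Unit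

/-- `φ_{1,2,3,4,k₁} φ_{4,5,6,7,k₂} φ_{7,3,8,9,k₃} φ_{9,6,2,10,k₄} φ_{10,8,5,1,k₅}`, with ten
variables in `Spin(4)` and five variables in `SU(2)`. -/
def bcPattern (v : Fin 5) : BCSlot → (Fin 10 × Bool) ⊕ Fin 5 :=
  Sum.map (Prod.map (ooguriPattern v) id) fun _ => v

/-- The map `(g_-^j, g_+^j; k) ↦ (g_-^j k u^j k⁻¹ h_-, g_+^j u^j h_+; h_-⁻¹ k h_+)`. -/
def bcMap (h : Bool → G) (u : Fin 4 → G) (x : BCSlot → G) : BCSlot → G :=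
  Sum.elim
    (fun p => match p with
      | (j, false) =>
          x (.inl (j, false)) * (x (.inr ()) * u j * (x (.inr ()))⁻¹) * h false
      | (j, true) => x (.inl (j, true)) * u j * h true)
    (fun _ => (h false)⁻¹ * x (.inr ()) * h true)

/-- The transformations of the combined gauge invariance and simplicity constraints. -/
def bcMaps (G : Type*) [Group G] : Set ((BCSlot → G) → (BCSlot → G)) :=
  {T | ∃ (h : Bool → G) (u : Fin 4 → G), T = bcMap h u}

/-- The average of a function over the simplicity transformations (`h = 1`). -/
def simplicityAverage [MeasurableSpace G] (μ : Measure G) (w : (BCSlot → G) → ℂ)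
    (x : BCSlot → G) : ℂ :=
  ∫ u : Fin 4 → G, w (bcMap 1 u x) ∂Measure.pi fun _ => μ

/-- Left multiplication of `(g₁, g₂, g₃, g₄; k)` by `(s₁, s₂, s₂, s₁)`, with `s₁`, `s₂`
one-parameter subgroups of `Spin(4)`; `σ i false` and `σ i true` are the two components. -/
def spinFlow {ρ : G →* Matrix (Fin N) (Fin N) ℂ} (σ : Fin 2 → Bool → OneParam ρ) :
    ℝ → (BCSlot → G) → (BCSlot → G) :=
  leftFlow (Sum.elim (fun p => σ (![0, 1, 1, 0] p.1) p.2) fun _ => OneParam.trivial ρ)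

/-- Couplings of the Barrett–Crane model: `κ` on the copies of `Spin(4)`, `κ'` on the normal. -/
def bcCoupling (κ κ' : ℝ) : BCSlot → ℝ := Sum.elim (fun _ => κ) fun _ => κ'

end GFT

end

/-!
Write vector fields on `M = G^ι` in the left-invariant frame `E_(A,a)`. For a bi-invariant metric,
left and right translations are isometries: pulling back along them rotates the frame by the adjoint
action. The simplicity transformations `g_- ↦ g_- k u k⁻¹` do so only in the directions in which `k`
is fixed, which is why they require `κ' = 0`.

*Field equation.* Let `I` be the sum, over the factors of the interaction monomial, of the integrals
with this factor omitted, and `W = κ Δ φ̄ - m φ̄ - λ I`. By integration by parts, `φ` is stationary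
iff `Re ∫ W η = 0` for all variations `η`. If `W` obeys the constraints on the fields, then
`η = W̄` is an admissible variation, whence `W = 0`. Otherwise `I` is first replaced by its average
over the constraint group: this does not change its pairing with the constrained `η`.

*Current.* Isometric flows and phase rotations preserve the local Lagrangian, so Noether's
computation gives `Div J = 2 Re ∑_c X_Q^c (κ Δ φ̄^c - m φ̄^c)`, in which the field equation
replaces the second factor by `λ I`.

*Coefficients.* When the interaction monomial has a symmetry that permutes its factors transitively,
relabelling the integration variables shows that all summands of `I` are equal.
-/

noncomputable section

namespace GFT

/-! ## Smoothness along an embedding -/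

section SmoothAlong

variable {X Y E E' F F' : Type*} [NormedAddCommGroup E] [NormedSpace ℝ E]
  [NormedAddCommGroup E'] [NormedSpace ℝ E'] [NormedAddCommGroup F] [NormedSpace ℝ F]
  [NormedAddCommGroup F'] [NormedSpace ℝ F'] {r : X → E} {s : Y → E'}

/-- `u` is the restriction along `r` of a smooth function on the normed space `E`. For the matrix
embedding of `ι → G` this is `IsSmooth`; for `r = id` it is `ContDiff ℝ ∞`. Letting `r` vary allows
for functions that depend on further parameters. -/
def SmoothAlong (r : X → E) (u : X → F) : Prop :=
  ∃ U : E → F, ContDiff ℝ ∞ U ∧ ∀ x, u x = U (r x)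

theorem smoothAlong_id_iff {u : E → F} : SmoothAlong id u ↔ ContDiff ℝ ∞ u := by
  refine ⟨?_, fun h => ⟨u, h, fun _ => rfl⟩⟩
  rintro ⟨U, hU, h⟩
  rwa [show u = U from funext h]

namespace SmoothAlong

theorem self (r : X → E) : SmoothAlong r r := ⟨id, contDiff_id, fun _ => rfl⟩

theorem const (r : X → E) (c : F) : SmoothAlong r fun _ => c :=
  ⟨fun _ => c, contDiff_const, fun _ => rfl⟩

theorem comp {u : X → F} (hu : SmoothAlong r u) {c : Y → X} (hc : SmoothAlong s (r ∘ c)) :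
    SmoothAlong s (u ∘ c) := by
  obtain ⟨U, hU, h⟩ := hu
  obtain ⟨V, hV, h'⟩ := hc
  exact ⟨U ∘ V, hU.comp hV, fun y => (h _).trans (congrArg U (h' y))⟩

theorem comp_fst {u : X → F} (hu : SmoothAlong r u) (s : Y → E') :
    SmoothAlong (Prod.map r s) fun p => u p.1 :=
  hu.comp ⟨Prod.fst, contDiff_fst, fun _ => rfl⟩

theorem comp_snd {v : Y → F} (hv : SmoothAlong s v) (r : X → E) :
    SmoothAlong (Prod.map r s) fun p => v p.2 :=
  hv.comp ⟨Prod.snd, contDiff_snd, fun _ => rfl⟩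

theorem contDiff_comp {u : X → F} (hu : SmoothAlong r u) {f : F → F'} (hf : ContDiff ℝ ∞ f) :
    SmoothAlong r fun x => f (u x) :=
  (smoothAlong_id_iff.2 hf).comp hu

theorem prodMk {u : X → F} {v : X → F'} (hu : SmoothAlong r u) (hv : SmoothAlong r v) :
    SmoothAlong r fun x => (u x, v x) := by
  obtain ⟨U, hU, h⟩ := hu
  obtain ⟨V, hV, h'⟩ := hv
  exact ⟨fun y => (U y, V y), hU.prodMk hV, fun x => Prod.ext (h x) (h' x)⟩

theorem pi {ι : Type*} [Fintype ι] {F : ι → Type*} [∀ i, NormedAddCommGroup (F i)]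
    [∀ i, NormedSpace ℝ (F i)] {u : X → ∀ i, F i} (hu : ∀ i, SmoothAlong r fun x => u x i) :
    SmoothAlong r u := by
  choose U hU h using hu
  exact ⟨fun y i => U i y, contDiff_pi.2 hU, fun x => funext fun i => h i x⟩

theorem continuous [TopologicalSpace X] (hr : Continuous r) {u : X → F} (hu : SmoothAlong r u) :
    Continuous u := by
  obtain ⟨U, hU, h⟩ := hu
  rw [show u = U ∘ r from funext h]
  exact hU.continuous.comp hr

theorem add {u v : X → F} (hu : SmoothAlong r u) (hv : SmoothAlong r v) :
    SmoothAlong r fun x => u x + v x :=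
  (hu.prodMk hv).contDiff_comp contDiff_add

theorem neg {u : X → F} (hu : SmoothAlong r u) : SmoothAlong r fun x => -u x :=
  hu.contDiff_comp contDiff_neg

theorem sub {u v : X → F} (hu : SmoothAlong r u) (hv : SmoothAlong r v) :
    SmoothAlong r fun x => u x - v x :=
  (hu.prodMk hv).contDiff_comp (contDiff_fst.sub contDiff_snd)

theorem mul {u v : X → ℂ} (hu : SmoothAlong r u) (hv : SmoothAlong r v) :
    SmoothAlong r fun x => u x * v x :=
  (hu.prodMk hv).contDiff_comp contDiff_mul

theorem sum {α : Type*} {t : Finset α} {u : α → X → F} (hu : ∀ a ∈ t, SmoothAlong r (u a)) :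
    SmoothAlong r fun x => ∑ a ∈ t, u a x := by
  classical
  induction t using Finset.induction_on with
  | empty => simpa using const r 0
  | insert a t ha ih =>
    simp only [Finset.sum_insert ha]
    exact (hu a (by simp)).add (ih fun b hb => hu b (by simp [hb]))

theorem prod {α : Type*} {t : Finset α} {u : α → X → ℂ} (hu : ∀ a ∈ t, SmoothAlong r (u a)) :
    SmoothAlong r fun x => ∏ a ∈ t, u a x := by
  classical
  induction t using Finset.induction_on with
  | empty => simpa using const r 1
  | insert a t ha ih =>
    simp only [Finset.prod_insert ha]
    exact (hu a (by simp)).mul (ih fun b hb => hu b (by simp [hb]))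

end SmoothAlong

theorem SmoothAlong.conj {u : X → ℂ} (hu : SmoothAlong r u) :
    SmoothAlong r fun x => starRingEnd ℂ (u x) :=
  hu.contDiff_comp Complex.conjCLE.contDiff

end SmoothAlong

/-! ## Mixed partial derivatives and parametric integrals -/

section PartialDerivatives

variable {E F : Type*} [NormedAddCommGroup E] [NormedSpace ℝ E] [NormedAddCommGroup F]
  [NormedSpace ℝ F]

theorem hasDerivAt_comp_prodMk_left {f : ℝ × E → F} {f' : ℝ × E →L[ℝ] F} {t : ℝ} {y : E}
    (hf : HasFDerivAt f f' (t, y)) : HasDerivAt (fun s => f (s, y)) (f' (1, 0)) t := by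
  simpa [Function.comp_def] using (hf.comp t (hasFDerivAt_prodMk_left t y)).hasDerivAt

theorem hasDerivAt_comp_prodMk_right {f : E × ℝ → F} {f' : E × ℝ →L[ℝ] F} {y : E} {t : ℝ}
    (hf : HasFDerivAt f f' (y, t)) : HasDerivAt (fun s => f (y, s)) (f' (0, 1)) t := by
  simpa [Function.comp_def] using (hf.comp t (hasFDerivAt_prodMk_right y t)).hasDerivAt

theorem deriv_deriv_comm {f : ℝ × ℝ → F} (hf : ContDiff ℝ 2 f) (s t : ℝ) :
    deriv (fun s => deriv (fun t => f (s, t)) t) s =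
      deriv (fun t => deriv (fun s => f (s, t)) s) t := by
  have hd (q) : HasFDerivAt f (fderiv ℝ f q) q :=
    (hf.differentiable two_ne_zero q).hasFDerivAt
  have hd2 : HasFDerivAt (fderiv ℝ f) (fderiv ℝ (fderiv ℝ f) (s, t)) (s, t) :=
    ((hf.fderiv_right (m := 1) le_rfl).differentiable one_ne_zero _).hasFDerivAt
  simp only [fun s t => (hasDerivAt_comp_prodMk_right (hd (s, t))).deriv,
    fun s t => (hasDerivAt_comp_prodMk_left (hd (s, t))).deriv]
  rw [((hasDerivAt_comp_prodMk_left hd2).clm_apply (hasDerivAt_const s _)).deriv,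
    ((hasDerivAt_comp_prodMk_right hd2).clm_apply (hasDerivAt_const t _)).deriv]
  simpa using (hf.contDiffAt.isSymmSndFDerivAt (by simp)).eq (1, 0) (0, 1)

end PartialDerivatives

section ParametricIntegral

variable {K F : Type*} [TopologicalSpace K] [CompactSpace K] [MeasurableSpace K] [BorelSpace K]
  {ν : Measure K} [IsFiniteMeasure ν] [NormedAddCommGroup F]

theorem integrable_of_continuous {f : K → F} (hf : Continuous f) : Integrable f ν :=
  hf.integrable_of_hasCompactSupport (.of_compactSpace f)

variable {P E : Type*} [NormedAddCommGroup P] [NormedSpace ℝ P] [FiniteDimensional ℝ P]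
  [NormedAddCommGroup E] [NormedSpace ℝ E] [NormedSpace ℝ F]

theorem hasFDerivAt_integral_of_contDiff {f : P × E → F} (hf : ContDiff ℝ 1 f) {r : K → E}
    (hr : Continuous r) (p : P) :
    HasFDerivAt (fun p => ∫ k, f (p, r k) ∂ν)
      (∫ k, fderiv ℝ f (p, r k) ∘L .inl ℝ P E ∂ν) p := by
  have : ProperSpace P := FiniteDimensional.proper_real P
  have hpair (q : P) : Continuous fun k => (q, r k) := continuous_const.prodMk hr
  have hcont : Continuous fun q : P × K => fderiv ℝ f (q.1, r q.2) ∘L .inl ℝ P E :=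
    ((hf.continuous_fderiv one_ne_zero).comp
      (continuous_fst.prodMk (hr.comp continuous_snd))).clm_comp continuous_const
  obtain ⟨C, hC⟩ := ((isCompact_closedBall p 1).prod (isCompact_univ (X := K))).bddAbove_image
    hcont.norm.continuousOn
  refine hasFDerivAt_integral_of_dominated_of_fderiv_le (𝕜 := ℝ) (μ := ν) (bound := fun _ => C)
    (F := fun p k => f (p, r k)) (F' := fun p k => fderiv ℝ f (p, r k) ∘L .inl ℝ P E)
    (Metric.closedBall_mem_nhds p one_pos) ?_ ?_ ?_ ?_ (integrable_const C) ?_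
  · exact .of_forall fun q =>
      (integrable_of_continuous (hf.continuous.comp (hpair q))).aestronglyMeasurable
  · exact integrable_of_continuous (hf.continuous.comp (hpair p))
  · exact (integrable_of_continuous (hcont.comp
      (continuous_const.prodMk continuous_id))).aestronglyMeasurable
  · exact .of_forall fun k q hq => hC ⟨(q, k), ⟨hq, Set.mem_univ k⟩, rfl⟩
  · exact .of_forall fun k q _ =>
      (hf.differentiable one_ne_zero _).hasFDerivAt.comp q (hasFDerivAt_prodMk_left q (r k))

theorem fderiv_integral_apply_of_contDiff {f : P × E → F} (hf : ContDiff ℝ 1 f) {r : K → E}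
    (hr : Continuous r) (p y : P) :
    fderiv ℝ (fun p => ∫ k, f (p, r k) ∂ν) p y = ∫ k, fderiv ℝ f (p, r k) (y, 0) ∂ν := by
  rw [(hasFDerivAt_integral_of_contDiff hf hr p).fderiv, ContinuousLinearMap.integral_apply]
  · simp
  · exact integrable_of_continuous (((hf.continuous_fderiv one_ne_zero).comp
      (continuous_const.prodMk hr)).clm_comp continuous_const)

theorem contDiff_integral_of_contDiff {f : P × E → F} (hf : ContDiff ℝ ∞ f) {r : K → E}
    (hr : Continuous r) : ContDiff ℝ ∞ fun p => ∫ k, f (p, r k) ∂ν := by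
  rw [contDiff_infty]
  intro n
  induction n generalizing f with
  | zero =>
    exact contDiff_zero.2 (continuous_iff_continuousAt.2 fun p =>
      (hasFDerivAt_integral_of_contDiff (hf.of_le (by simp)) hr p).continuousAt)
  | succ n ih =>
    have hf1 : ContDiff ℝ 1 f := hf.of_le (by simp)
    push_cast
    refine contDiff_succ_iff_fderiv_apply.2
      ⟨fun p => (hasFDerivAt_integral_of_contDiff hf1 hr p).differentiableAt, by simp, fun y => ?_⟩
    simp only [fderiv_integral_apply_of_contDiff hf1 hr]
    exact ih ((hf.fderiv_right (m := ∞) (by simp)).clm_apply contDiff_const)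

theorem SmoothAlong.integral {X : Type*} {r : X → P} {s : K → E} (hs : Continuous s)
    {u : X → K → F} (hu : SmoothAlong (Prod.map r s) fun p => u p.1 p.2) :
    SmoothAlong r fun x => ∫ k, u x k ∂ν := by
  obtain ⟨U, hU, h⟩ := hu
  exact ⟨fun p => ∫ k, U (p, s k) ∂ν, contDiff_integral_of_contDiff hU hs,
    fun x => integral_congr_ae (.of_forall fun k => h (x, k))⟩

theorem SmoothAlong.hasDerivAt_integral {s : K → E} (hs : Continuous s) {u : ℝ → K → F}
    (hu : SmoothAlong (Prod.map id s) fun p => u p.1 p.2) (t : ℝ) :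
    HasDerivAt (fun t => ∫ k, u t k ∂ν) (∫ k, deriv (fun t => u t k) t ∂ν) t := by
  obtain ⟨U, hU, h⟩ := hu
  obtain rfl : u = fun t k => U (t, s k) := funext₂ fun t k => h (t, k)
  have hU1 : ContDiff ℝ 1 U := hU.of_le (by simp)
  have hd (k) : deriv (fun t => U (t, s k)) t = fderiv ℝ U (t, s k) (1, 0) :=
    (hasDerivAt_comp_prodMk_left (hU1.differentiable one_ne_zero _).hasFDerivAt).deriv
  simp only [hd, ← fderiv_integral_apply_of_contDiff hU1 hs]
  exact (hasFDerivAt_integral_of_contDiff hU1 hs t).differentiableAt.hasDerivAt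

end ParametricIntegral

/-! ## Smooth group-valued maps -/

section SmoothGroup

variable {G : Type*} [Group G] {N : ℕ} {ι : Type*} {ρ : G →* Matrix (Fin N) (Fin N) ℂ}
variable {X Y E E' : Type*} [NormedAddCommGroup E] [NormedSpace ℝ E] [NormedAddCommGroup E']
  [NormedSpace ℝ E'] {r : X → E} {s : Y → E'}

/-- The embedding of `ι → G` into tuples of matrices, through which `IsSmooth` is defined. -/
def matEmb (ρ : G →* Matrix (Fin N) (Fin N) ℂ) (x : ι → G) : ι → Fin N → Fin N → ℂ :=
  fun A i j => ρ (x A) i j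

/-- Smoothness of a group-valued map `c`: its matrix coefficients are restrictions along `r` of
smooth functions. -/
def SmoothGroup (ρ : G →* Matrix (Fin N) (Fin N) ℂ) (r : X → E) (c : X → G) : Prop :=
  ∀ i j, SmoothAlong r fun x => ρ (c x) i j

theorem SmoothGroup.const (r : X → E) (g : G) : SmoothGroup ρ r fun _ => g :=
  fun _ _ => SmoothAlong.const _ _

theorem SmoothGroup.comp {c : X → G} (hc : SmoothGroup ρ r c) {f : Y → X}
    (hf : SmoothAlong s (r ∘ f)) : SmoothGroup ρ s fun y => c (f y) :=
  fun i j => (hc i j).comp hf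

theorem SmoothGroup.mul {c c' : X → G} (hc : SmoothGroup ρ r c) (hc' : SmoothGroup ρ r c') :
    SmoothGroup ρ r fun x => c x * c' x := by
  intro i j
  simp only [map_mul, Matrix.mul_apply]
  exact SmoothAlong.sum fun k _ => (hc i k).mul (hc' k j)

theorem OneParam.smoothGroup (γ : OneParam ρ) {τ : X → ℝ} (hτ : SmoothAlong r τ) :
    SmoothGroup ρ r fun x => γ (τ x) :=
  fun i j => hτ.contDiff_comp (γ.smooth i j)

theorem SmoothGroup.update [DecidableEq ι] {c : X → ι → G}
    (hc : ∀ A, SmoothGroup ρ r fun x => c x A) (A : ι) {g : X → G} (hg : SmoothGroup ρ r g)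
    (B : ι) : SmoothGroup ρ r fun x => Function.update (c x) A (g x) B := by
  obtain rfl | h := eq_or_ne B A
  · simpa using hg
  · simpa [h] using hc B

variable [Fintype ι]

theorem smoothAlong_matEmb_iff {c : X → ι → G} :
    SmoothAlong r (matEmb ρ ∘ c) ↔ ∀ A, SmoothGroup ρ r fun x => c x A := by
  refine ⟨fun h A i j => ?_, fun h => .pi fun A => .pi fun i => .pi fun j => h A i j⟩
  exact h.contDiff_comp (f := fun Y : ι → Fin N → Fin N → ℂ => Y A i j) (by fun_prop)

theorem smoothGroup_apply (ρ : G →* Matrix (Fin N) (Fin N) ℂ) (A : ι) :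
    SmoothGroup ρ (matEmb ρ) fun x : ι → G => x A :=
  smoothAlong_matEmb_iff.1 (.self _) A

theorem IsSmooth.comp_smoothGroup {u : (ι → G) → ℂ} (hu : IsSmooth ρ u) {c : X → ι → G}
    (hc : ∀ A, SmoothGroup ρ r fun x => c x A) : SmoothAlong r fun x => u (c x) :=
  SmoothAlong.comp (r := matEmb ρ) hu (smoothAlong_matEmb_iff.2 hc)

variable {u v : (ι → G) → ℂ}

theorem IsSmooth.add (hu : IsSmooth ρ u) (hv : IsSmooth ρ v) : IsSmooth ρ fun x => u x + v x :=
  SmoothAlong.add hu hv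

theorem IsSmooth.mul (hu : IsSmooth ρ u) (hv : IsSmooth ρ v) : IsSmooth ρ fun x => u x * v x :=
  SmoothAlong.mul hu hv

theorem IsSmooth.const_mul (hu : IsSmooth ρ u) (z : ℂ) : IsSmooth ρ fun x => z * u x :=
  SmoothAlong.mul (.const _ z) hu

theorem IsSmooth.sum {α : Type*} {s : Finset α} {u : α → (ι → G) → ℂ}
    (hu : ∀ a ∈ s, IsSmooth ρ (u a)) : IsSmooth ρ fun x => ∑ a ∈ s, u a x :=
  SmoothAlong.sum hu

theorem IsSmooth.conj (hu : IsSmooth ρ u) : IsSmooth ρ fun x => starRingEnd ℂ (u x) :=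
  SmoothAlong.conj hu

end SmoothGroup

/-! ## One-parameter subgroups and invariant metrics -/

section OneParam

variable {G : Type*} [Group G] {N d : ℕ} {ρ : G →* Matrix (Fin N) (Fin N) ℂ}

/-- The curve `c` in `G` is differentiable at `0`, with velocity the matrix `v`. -/
def HasVelocity (ρ : G →* Matrix (Fin N) (Fin N) ℂ) (c : ℝ → G) (v : Matrix (Fin N) (Fin N) ℂ) :
    Prop :=
  ∀ i j, HasDerivAt (fun t => ρ (c t) i j) (v i j) 0

theorem HasVelocity.velocity_eq {c : ℝ → G} {v : Matrix (Fin N) (Fin N) ℂ}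
    (h : HasVelocity ρ c v) : velocity ρ c = v :=
  Matrix.ext fun i j => (h i j).deriv

theorem SmoothGroup.hasVelocity {c : ℝ → G} (hc : SmoothGroup ρ id c) :
    HasVelocity ρ c (velocity ρ c) := fun i j =>
  ((smoothAlong_id_iff.1 (hc i j)).differentiable (by simp) 0).hasDerivAt

theorem HasVelocity.const (g : G) : HasVelocity ρ (fun _ => g) 0 :=
  fun _ _ => hasDerivAt_const _ _

theorem HasVelocity.mul {c c' : ℝ → G} {v v' : Matrix (Fin N) (Fin N) ℂ}
    (h : HasVelocity ρ c v) (h' : HasVelocity ρ c' v') :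
    HasVelocity ρ (fun t => c t * c' t) (v * ρ (c' 0) + ρ (c 0) * v') := by
  intro i j
  simp only [map_mul, Matrix.mul_apply, Matrix.add_apply, ← Finset.sum_add_distrib]
  exact HasDerivAt.fun_sum fun k _ => (h i k).mul (h' k j)

namespace OneParam

theorem map_zero (γ : OneParam ρ) : γ 0 = 1 := by
  simpa using γ.map_add 0 0

theorem map_neg (γ : OneParam ρ) (t : ℝ) : γ (-t) = (γ t)⁻¹ :=
  eq_inv_of_mul_eq_one_left (by rw [← γ.map_add, neg_add_cancel, γ.map_zero])

theorem map_comm (γ : OneParam ρ) (s t : ℝ) : γ s * γ t = γ t * γ s := by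
  rw [← γ.map_add, add_comm, γ.map_add]

theorem smoothGroup_inv {X E : Type*} [NormedAddCommGroup E] [NormedSpace ℝ E] {r : X → E}
    (γ : OneParam ρ) {τ : X → ℝ} (hτ : SmoothAlong r τ) :
    SmoothGroup ρ r fun x => (γ (τ x))⁻¹ := by
  simp only [← γ.map_neg]
  exact γ.smoothGroup hτ.neg

theorem hasVelocity (γ : OneParam ρ) : HasVelocity ρ γ (velocity ρ γ) :=
  (γ.smoothGroup (.self id)).hasVelocity

theorem hasVelocity_inv (γ : OneParam ρ) : HasVelocity ρ (fun t => (γ t)⁻¹) (-velocity ρ γ) := by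
  intro i j
  have h : HasDerivAt (fun t => ρ (γ t) i j) (velocity ρ γ i j) (-0) := by
    simpa using γ.hasVelocity i j
  simpa [← γ.map_neg, Function.comp_def] using h.scomp (0 : ℝ) (hasDerivAt_neg 0)

/-- The conjugate one-parameter subgroup `g γ g⁻¹`, with velocity `Ad g` of that of `γ`. -/
def conjBy (g : G) (γ : OneParam ρ) : OneParam ρ where
  toFun t := g * γ t * g⁻¹
  map_add s t := by rw [γ.map_add]; group
  smooth i j := smoothAlong_id_iff.1 (((SmoothGroup.const _ g).mul
    (γ.smoothGroup (.self id))).mul (.const _ g⁻¹) i j)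

theorem conjBy_one (γ : OneParam ρ) : γ.conjBy 1 = γ := by simp [conjBy]

theorem conjBy_mul (g h : G) (γ : OneParam ρ) : γ.conjBy (g * h) = (γ.conjBy h).conjBy g := by
  simp only [conjBy, mul_inv_rev, mul_assoc]

theorem velocity_conjBy (g : G) (γ : OneParam ρ) :
    velocity ρ (γ.conjBy g) = ρ g * velocity ρ γ * ρ g⁻¹ := by
  have h := ((HasVelocity.const g).mul γ.hasVelocity).mul (.const (ρ := ρ) g⁻¹)
  exact h.velocity_eq.trans (by simp [γ.map_zero])

theorem conjBy_self (γ : OneParam ρ) (t : ℝ) : γ.conjBy (γ t) = γ := by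
  have h : (fun s => γ t * γ s * (γ t)⁻¹) = γ :=
    funext fun s => by rw [γ.map_comm t s, mul_inv_cancel_right]
  cases γ
  simpa [conjBy] using h

end OneParam

namespace InvariantMetric

variable (Q : InvariantMetric ρ d)

theorem eq_sum_smul_velocity {w : Matrix (Fin N) (Fin N) ℂ}
    (hw : w ∈ Submodule.span ℝ (Set.range fun a => velocity ρ (Q.e a))) :
    w = ∑ a, Q.B w (velocity ρ (Q.e a)) • velocity ρ (Q.e a) := by
  obtain ⟨c, rfl⟩ := (Submodule.mem_span_range_iff_exists_fun ℝ).1 hw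
  simp [map_sum, LinearMap.sum_apply, Q.orthonormal]

theorem parseval (γ δ : OneParam ρ) :
    Q.B (velocity ρ γ) (velocity ρ δ) =
      ∑ a, Q.B (velocity ρ γ) (velocity ρ (Q.e a)) * Q.B (velocity ρ δ) (velocity ρ (Q.e a)) := by
  conv_lhs => rw [Q.eq_sum_smul_velocity (Q.spanning δ)]
  simp [map_sum, mul_comm]

theorem symm (γ δ : OneParam ρ) :
    Q.B (velocity ρ γ) (velocity ρ δ) = Q.B (velocity ρ δ) (velocity ρ γ) := by
  simp only [Q.parseval γ δ, Q.parseval δ γ, mul_comm]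

theorem conjBy_conjBy (g : G) (γ δ : OneParam ρ) :
    Q.B (velocity ρ (γ.conjBy g)) (velocity ρ (δ.conjBy g)) =
      Q.B (velocity ρ γ) (velocity ρ δ) := by
  rw [OneParam.velocity_conjBy, OneParam.velocity_conjBy, Q.ad_invariant]

theorem conjBy_left (g : G) (γ δ : OneParam ρ) :
    Q.B (velocity ρ (γ.conjBy g)) (velocity ρ δ) =
      Q.B (velocity ρ γ) (velocity ρ (δ.conjBy g⁻¹)) := by
  rw [← Q.conjBy_conjBy g⁻¹ (γ.conjBy g) δ, ← OneParam.conjBy_mul, inv_mul_cancel,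
    OneParam.conjBy_one]

theorem adjoint_orthogonal (g : G) (b c : Fin d) :
    ∑ a, Q.B (velocity ρ ((Q.e a).conjBy g)) (velocity ρ (Q.e b)) *
      Q.B (velocity ρ ((Q.e a).conjBy g)) (velocity ρ (Q.e c)) = if b = c then 1 else 0 := by
  simp only [Q.conjBy_left g, Q.symm (Q.e _) ((Q.e _).conjBy g⁻¹)]
  rw [← Q.parseval, Q.conjBy_conjBy, Q.orthonormal]

end InvariantMetric

end OneParam

/-! ## Smooth families of transformations -/

section SmoothFamily

theorem lieDeriv_const_mul {G ι : Type*} (Φ : ℝ → (ι → G) → (ι → G)) (z : ℂ)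
    (u : (ι → G) → ℂ) (x : ι → G) : lieDeriv Φ (fun y => z * u y) x = z * lieDeriv Φ u x :=
  deriv_const_mul_field z

theorem lieDeriv_conj {G ι : Type*} (Φ : ℝ → (ι → G) → (ι → G)) (u : (ι → G) → ℂ) (x : ι → G) :
    lieDeriv Φ (fun y => conj (u y)) x = conj (lieDeriv Φ u x) :=
  deriv.star

variable {G : Type*} [Group G] {N : ℕ} {ι : Type*} [Fintype ι] {ρ : G →* Matrix (Fin N) (Fin N) ℂ}

/-- A smooth one-parameter family of transformations of `M = ι → G` that starts at the identity.
It need not be a flow: only its generator at time `0` matters. -/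
structure IsSmoothFamily (ρ : G →* Matrix (Fin N) (Fin N) ℂ) (Φ : ℝ → (ι → G) → (ι → G)) :
    Prop where
  zero : ∀ x, Φ 0 x = x
  smooth : ∀ A, SmoothGroup ρ (Prod.map id (matEmb ρ)) fun p : ℝ × (ι → G) => Φ p.1 p.2 A

namespace IsSmoothFamily

variable {Φ Ψ : ℝ → (ι → G) → (ι → G)} (hΦ : IsSmoothFamily ρ Φ) {u v : (ι → G) → ℂ}
include hΦ

theorem smoothAlong_comp (hu : IsSmooth ρ u) :
    SmoothAlong (Prod.map id (matEmb ρ)) fun p : ℝ × (ι → G) => u (Φ p.1 p.2) :=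
  hu.comp_smoothGroup hΦ.smooth

theorem smoothGroup_orbit {X E : Type*} [NormedAddCommGroup E] [NormedSpace ℝ E] {r : X → E}
    {τ : X → ℝ} (hτ : SmoothAlong r τ) {c : X → ι → G} (hc : ∀ A, SmoothGroup ρ r fun y => c y A)
    (A : ι) : SmoothGroup ρ r fun y => Φ (τ y) (c y) A :=
  (hΦ.smooth A).comp (f := fun y => (τ y, c y)) (hτ.prodMk (smoothAlong_matEmb_iff.2 hc))

theorem hasDerivAt (hu : IsSmooth ρ u) (x : ι → G) :
    HasDerivAt (fun t => u (Φ t x)) (lieDeriv Φ u x) 0 :=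
  ((smoothAlong_id_iff.1 (hu.comp_smoothGroup fun A =>
    hΦ.smoothGroup_orbit (.self id) (fun A => .const _ (x A)) A)).differentiable
      (by simp) 0).hasDerivAt

theorem isSmooth_lieDeriv (hu : IsSmooth ρ u) : IsSmooth ρ (lieDeriv Φ u) := by
  obtain ⟨U, hU, h⟩ := hΦ.smoothAlong_comp hu
  refine ⟨fun X => fderiv ℝ U (0, X) (1, 0), ((hU.fderiv_right (m := ∞) (by simp)).comp
    (contDiff_const.prodMk contDiff_id)).clm_apply contDiff_const, fun x => ?_⟩
  simp only [lieDeriv, fun t => h (t, x)]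
  exact (hasDerivAt_comp_prodMk_left (hU.differentiable (by simp) _).hasFDerivAt).deriv

theorem lieDeriv_add (hu : IsSmooth ρ u) (hv : IsSmooth ρ v) (x : ι → G) :
    lieDeriv Φ (fun y => u y + v y) x = lieDeriv Φ u x + lieDeriv Φ v x :=
  ((hΦ.hasDerivAt hu x).add (hΦ.hasDerivAt hv x)).deriv

theorem lieDeriv_sum {α : Type*} {s : Finset α} {u : α → (ι → G) → ℂ}
    (hu : ∀ a ∈ s, IsSmooth ρ (u a)) (x : ι → G) :
    lieDeriv Φ (fun y => ∑ a ∈ s, u a y) x = ∑ a ∈ s, lieDeriv Φ (u a) x :=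
  (HasDerivAt.fun_sum fun a ha => hΦ.hasDerivAt (hu a ha) x).deriv

theorem lieDeriv_mul (hu : IsSmooth ρ u) (hv : IsSmooth ρ v) (x : ι → G) :
    lieDeriv Φ (fun y => u y * v y) x = lieDeriv Φ u x * v x + u x * lieDeriv Φ v x := by
  simpa [hΦ.zero, lieDeriv] using ((hΦ.hasDerivAt hu x).fun_mul (hΦ.hasDerivAt hv x)).deriv

theorem hasDerivAt_lieDeriv_comp (hΨ : IsSmoothFamily ρ Ψ) (hu : IsSmooth ρ u) (x : ι → G) :
    HasDerivAt (fun t => lieDeriv Ψ (u ∘ Φ t) x) (lieDeriv Ψ (lieDeriv Φ u) x) 0 := by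
  let f : ℝ × ℝ → ℂ := fun q => u (Φ q.2 (Ψ q.1 x))
  have hf : ContDiff ℝ ∞ f := smoothAlong_id_iff.1 <| hu.comp_smoothGroup fun A =>
    hΦ.smoothGroup_orbit (smoothAlong_id_iff.2 contDiff_snd) (fun A =>
      hΨ.smoothGroup_orbit (smoothAlong_id_iff.2 contDiff_fst) (fun A => .const _ (x A)) A) A
  have hderiv : (fun t => deriv (fun s => f (s, t)) 0) = fun t => fderiv ℝ f (0, t) (1, 0) :=
    funext fun t => (hasDerivAt_comp_prodMk_left
      (hf.differentiable (by simp) (0, t)).hasFDerivAt).deriv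
  have hdiff : DifferentiableAt ℝ (fun t => deriv (fun s => f (s, t)) 0) 0 := by
    rw [hderiv]
    exact (((hf.fderiv_right (m := ∞) (by simp)).comp (contDiff_const.prodMk contDiff_id)).clm_apply
      contDiff_const).differentiable (by simp) 0
  exact hdiff.hasDerivAt.congr_deriv (deriv_deriv_comm (hf.of_le ENat.LEInfty.out) 0 0).symm

end IsSmoothFamily

end SmoothFamily

/-! ## The differential in the left-invariant frame -/

section Frame

variable {G : Type*} [Group G] {N d : ℕ} {ι : Type*} {ρ : G →* Matrix (Fin N) (Fin N) ℂ}

/-- Right translation of the `A`-th copy of `G` by a one-parameter subgroup. For the subgroup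
`Q.e a` its generator is the field `E_(A,a)` of the frame. -/
def rightFlow [DecidableEq ι] (A : ι) (δ : OneParam ρ) (t : ℝ) (x : ι → G) : ι → G :=
  Function.update x A (x A * δ t)

/-- The two-sided translations `x A ↦ α A t * x A * (β A t)⁻¹`. Left multiplications and
conjugations are of this form. -/
def biFlow (α β : ι → OneParam ρ) (t : ℝ) (x : ι → G) : ι → G :=
  fun A => α A t * x A * (β A t)⁻¹

theorem leftFlow_eq_biFlow (γ : ι → OneParam ρ) : leftFlow γ = biFlow γ fun _ => .trivial ρ := by
  funext t x A
  simp [leftFlow, biFlow, OneParam.trivial]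

theorem trivialFlow_eq_biFlow (ρ : G →* Matrix (Fin N) (Fin N) ℂ) :
    (trivialFlow : ℝ → (ι → G) → (ι → G)) = biFlow (fun _ => .trivial ρ) fun _ => .trivial ρ := by
  funext t x A
  simp [trivialFlow, biFlow, OneParam.trivial]

theorem hasVelocity_inv_mul_biFlow (α β : ι → OneParam ρ) (x : ι → G) (A : ι) :
    HasVelocity ρ (fun t => (x A)⁻¹ * biFlow α β t x A)
      (velocity ρ ((α A).conjBy (x A)⁻¹) - velocity ρ (β A)) := by
  simpa [OneParam.conjBy, OneParam.map_zero, mul_assoc, biFlow, sub_eq_add_neg] using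
    ((α A).conjBy (x A)⁻¹).hasVelocity.mul (β A).hasVelocity_inv

theorem hasVelocity_inv_mul_rightFlow [DecidableEq ι] (A B : ι) (δ : OneParam ρ) (x : ι → G) :
    HasVelocity ρ (fun t => (x B)⁻¹ * rightFlow A δ t x B)
      (Pi.single (M := fun _ => Matrix (Fin N) (Fin N) ℂ) A (velocity ρ δ) B) := by
  obtain rfl | h := eq_or_ne B A
  · simpa [rightFlow] using δ.hasVelocity
  · simpa [rightFlow, h] using HasVelocity.const (ρ := ρ) 1

theorem frameDeriv_eq_lieDeriv [DecidableEq ι] (Q : InvariantMetric ρ d) (A : ι) (a : Fin d) :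
    frameDeriv Q A a = lieDeriv (rightFlow A (Q.e a)) := rfl

theorem frameDeriv_conj [DecidableEq ι] (Q : InvariantMetric ρ d) (A : ι) (a : Fin d)
    (u : (ι → G) → ℂ) (x : ι → G) :
    frameDeriv Q A a (fun y => conj (u y)) x = conj (frameDeriv Q A a u x) :=
  lieDeriv_conj (rightFlow A (Q.e a)) u x

theorem generatorComponent_biFlow (Q : InvariantMetric ρ d) (α β : ι → OneParam ρ) (A : ι)
    (a : Fin d) (x : ι → G) :
    generatorComponent Q (biFlow α β) A a x =
      Q.B (velocity ρ ((α A).conjBy (x A)⁻¹)) (velocity ρ (Q.e a)) -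
        Q.B (velocity ρ (β A)) (velocity ρ (Q.e a)) := by
  rw [generatorComponent, (hasVelocity_inv_mul_biFlow α β x A).velocity_eq, map_sub,
    LinearMap.sub_apply]

theorem generatorComponent_rightFlow [DecidableEq ι] (Q : InvariantMetric ρ d)
    (α β : ι → OneParam ρ) (A : ι) (a : Fin d) (t : ℝ) (x : ι → G) :
    generatorComponent Q (biFlow α β) A a (rightFlow A (Q.e a) t x) =
      generatorComponent Q (biFlow α β) A a x := by
  rw [generatorComponent_biFlow, generatorComponent_biFlow, rightFlow, Function.update_self,
    mul_inv_rev, OneParam.conjBy_mul, Q.conjBy_left, inv_inv, OneParam.conjBy_self]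

variable [Fintype ι]

theorem isSmoothFamily_biFlow (α β : ι → OneParam ρ) : IsSmoothFamily ρ (biFlow α β) where
  zero x := funext fun A => by simp [biFlow, OneParam.map_zero]
  smooth A := (((α A).smoothGroup ((SmoothAlong.self id).comp_fst _)).mul
    ((smoothGroup_apply ρ A).comp ((SmoothAlong.self _).comp_snd _))).mul
      ((β A).smoothGroup_inv ((SmoothAlong.self id).comp_fst _))

theorem IsSmooth.exists_differential {u : (ι → G) → ℂ} (hu : IsSmooth ρ u) (x : ι → G) :
    ∃ L : (ι → Matrix (Fin N) (Fin N) ℂ) →ₗ[ℝ] ℂ, ∀ (c : ℝ → ι → G) w, c 0 = x →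
      (∀ A, HasVelocity ρ (fun t => (x A)⁻¹ * c t A) (w A)) →
        HasDerivAt (fun t => u (c t)) (L w) 0 := by
  obtain ⟨F, hF, hu⟩ := hu
  let L : (ι → Matrix (Fin N) (Fin N) ℂ) →ₗ[ℝ] ℂ :=
    (fderiv ℝ F (matEmb ρ x)).toLinearMap ∘ₗ LinearMap.pi fun A =>
      (Matrix.ofLinearEquiv ℝ).symm.toLinearMap ∘ₗ LinearMap.mulLeft ℝ (ρ (x A)) ∘ₗ
        LinearMap.proj A
  refine ⟨L, ?_⟩
  rintro c w rfl hc
  have hcurve : HasDerivAt (fun t => matEmb ρ (c t))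
      (fun A => Matrix.of.symm (ρ (c 0 A) * w A)) 0 :=
    hasDerivAt_pi.2 fun A => hasDerivAt_pi.2 fun i => hasDerivAt_pi.2 fun j => by
      have h := (HasVelocity.const (c 0 A)).mul (hc A) i j
      simp only [mul_inv_cancel_left, zero_mul, zero_add] at h
      exact h
  simp only [hu]
  exact (hF.differentiable (by simp) _).hasFDerivAt.comp_hasDerivAt (0 : ℝ) hcurve

variable [DecidableEq ι]

theorem isSmoothFamily_rightFlow (A : ι) (δ : OneParam ρ) :
    IsSmoothFamily ρ (rightFlow A δ) where
  zero x := by simp [rightFlow, δ.map_zero]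
  smooth B := SmoothGroup.update
    (fun B => (smoothGroup_apply ρ B).comp ((SmoothAlong.self _).comp_snd _)) A
    (((smoothGroup_apply ρ A).comp ((SmoothAlong.self _).comp_snd _)).mul
      (δ.smoothGroup ((SmoothAlong.self id).comp_fst _))) B

variable (Q : InvariantMetric ρ d)

theorem IsSmooth.frameDeriv {u : (ι → G) → ℂ} (hu : IsSmooth ρ u) (A : ι) (a : Fin d) :
    IsSmooth ρ (frameDeriv Q A a u) :=
  (isSmoothFamily_rightFlow A (Q.e a)).isSmooth_lieDeriv hu

theorem lieDeriv_eq_sum_frameDeriv {Φ : ℝ → (ι → G) → (ι → G)} {x : ι → G}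
    {w : ι → Matrix (Fin N) (Fin N) ℂ} (hΦ : Φ 0 x = x)
    (hw : ∀ A, HasVelocity ρ (fun t => (x A)⁻¹ * Φ t x A) (w A))
    (hspan : ∀ A, w A ∈ Submodule.span ℝ (Set.range fun a => velocity ρ (Q.e a)))
    {u : (ι → G) → ℂ} (hu : IsSmooth ρ u) :
    lieDeriv Φ u x = ∑ A, ∑ a, (Q.B (w A) (velocity ρ (Q.e a)) : ℂ) * frameDeriv Q A a u x := by
  obtain ⟨L, hL⟩ := hu.exists_differential x
  have hframe (A a) : frameDeriv Q A a u x = L (Pi.single A (velocity ρ (Q.e a))) :=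
    (hL (fun t => rightFlow A (Q.e a) t x) _ ((isSmoothFamily_rightFlow A (Q.e a)).zero x)
      fun B => hasVelocity_inv_mul_rightFlow A B (Q.e a) x).deriv
  have hwsum : w = ∑ A, ∑ a, Q.B (w A) (velocity ρ (Q.e a)) •
      Pi.single (M := fun _ => Matrix (Fin N) (Fin N) ℂ) A (velocity ρ (Q.e a)) := by
    conv_lhs => rw [← Finset.univ_sum_single w]
    refine Finset.sum_congr rfl fun A _ => ?_
    conv_lhs => rw [Q.eq_sum_smul_velocity (hspan A)]
    exact (map_sum (LinearMap.single ℝ _ A) _ _).trans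
      (Finset.sum_congr rfl fun a _ => map_smul (LinearMap.single ℝ _ A) _ _)
  calc lieDeriv Φ u x = L w := (hL (fun t => Φ t x) w hΦ hw).deriv
    _ = _ := by
      conv_lhs => rw [hwsum]
      simp only [map_sum, map_smul, Complex.real_smul, hframe]

theorem lieDeriv_rightFlow_eq_sum (A : ι) (δ : OneParam ρ) {u : (ι → G) → ℂ} (hu : IsSmooth ρ u)
    (x : ι → G) :
    lieDeriv (rightFlow A δ) u x =
      ∑ a, (Q.B (velocity ρ δ) (velocity ρ (Q.e a)) : ℂ) * frameDeriv Q A a u x := by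
  rw [lieDeriv_eq_sum_frameDeriv Q ((isSmoothFamily_rightFlow A δ).zero x)
    (fun B => hasVelocity_inv_mul_rightFlow A B δ x) (fun B => ?_) hu,
    Finset.sum_eq_single_of_mem A (mem_univ A) fun B _ h => by simp [h]]
  · simp
  · obtain rfl | h := eq_or_ne B A
    · simpa using Q.spanning δ
    · simp [h]

variable (α β : ι → OneParam ρ)

theorem lieDeriv_biFlow_eq_sum {u : (ι → G) → ℂ} (hu : IsSmooth ρ u) (x : ι → G) :
    lieDeriv (biFlow α β) u x =
      ∑ A, ∑ a, (generatorComponent Q (biFlow α β) A a x : ℂ) * frameDeriv Q A a u x := by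
  simp only [generatorComponent, (hasVelocity_inv_mul_biFlow α β x _).velocity_eq]
  exact lieDeriv_eq_sum_frameDeriv Q ((isSmoothFamily_biFlow α β).zero x)
    (hasVelocity_inv_mul_biFlow α β x)
    (fun A => Submodule.sub_mem _ (Q.spanning _) (Q.spanning _)) hu

end Frame

/-! ## Isometries that permute the frame up to the adjoint action -/

section Isometry

variable {G : Type*} [Group G] {N d : ℕ} {ι : Type*} [DecidableEq ι]
  {ρ : G →* Matrix (Fin N) (Fin N) ℂ}

/-- At the point `x`, the map `T` intertwines right translations of the slot `A` with right
translations of the slot `B`, up to conjugation by `g`. -/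
def TranslatesSlotAt (T : (ι → G) → ι → G) (x : ι → G) (A B : ι) (g : G) : Prop :=
  ∀ y, T (Function.update x A (x A * y)) = Function.update (T x) B (T x B * (g * y * g⁻¹))

namespace TranslatesSlotAt

variable {T : (ι → G) → ι → G} {x : ι → G} {A B : ι} {g : G}

theorem update (h : TranslatesSlotAt T x A B g) (z : G) :
    TranslatesSlotAt T (Function.update x A (x A * z)) A B g := by
  intro y
  rw [Function.update_self, Function.update_idem, mul_assoc, h, h, Function.update_self,
    Function.update_idem]
  group

theorem lieDeriv_comp (h : TranslatesSlotAt T x A B g) (δ : OneParam ρ) (u : (ι → G) → ℂ) :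
    lieDeriv (rightFlow A δ) (u ∘ T) x = lieDeriv (rightFlow B (δ.conjBy g)) u (T x) :=
  congrArg (deriv · 0) (funext fun t => congrArg u (h (δ t)))

theorem lieDeriv_lieDeriv_comp (h : TranslatesSlotAt T x A B g) (δ : OneParam ρ)
    (u : (ι → G) → ℂ) :
    lieDeriv (rightFlow A δ) (lieDeriv (rightFlow A δ) (u ∘ T)) x =
      lieDeriv (rightFlow B (δ.conjBy g)) (lieDeriv (rightFlow B (δ.conjBy g)) u) (T x) := by
  rw [← h.lieDeriv_comp]
  exact congrArg (deriv · 0) (funext fun t => (h.update (δ t)).lieDeriv_comp δ u)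

end TranslatesSlotAt

/-- Isometries that map the left-invariant frame of every slot `A` with coupling `κ A ≠ 0`, up to
a rotation of the Lie algebra by the adjoint action, to that of a slot with the same coupling. -/
def IsFrameIsometry (κ : ι → ℝ) (T : (ι → G) → ι → G) : Prop :=
  ∃ π : Equiv.Perm ι, (∀ A, κ (π A) = κ A) ∧
    ∀ x, ∃ g : ι → G, ∀ A, κ A ≠ 0 → TranslatesSlotAt T x A (π A) (g A)

theorem isFrameIsometry_biFlow (κ : ι → ℝ) (α β : ι → OneParam ρ) (t : ℝ) :
    IsFrameIsometry κ (biFlow α β t) := by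
  refine ⟨1, fun _ => rfl, fun x => ⟨fun A => β A t, fun A _ y => funext fun B => ?_⟩⟩
  obtain rfl | h := eq_or_ne B A
  · simp [biFlow, mul_assoc]
  · simp [biFlow, h]

theorem isFrameIsometry_of_mem_gaugeMaps (κ : ι → ℝ) {T : (ι → G) → ι → G}
    (hT : T ∈ gaugeMaps G ι) : IsFrameIsometry κ T := by
  obtain ⟨h, rfl⟩ := hT
  refine ⟨1, fun _ => rfl, fun x => ⟨fun _ => h⁻¹, fun A _ y => funext fun B => ?_⟩⟩
  obtain rfl | hBA := eq_or_ne B A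
  · simp [mul_assoc]
  · simp [hBA]

theorem isFrameIsometry_of_mem_cyclicMaps (κ : ℝ) {T : (Fin 3 → G) → Fin 3 → G}
    (hT : T ∈ cyclicMaps G) : IsFrameIsometry (fun _ => κ) T := by
  obtain ⟨r, rfl⟩ := hT
  refine ⟨Equiv.subRight r, fun _ => rfl, fun x => ⟨1, fun A _ y => funext fun B => ?_⟩⟩
  obtain h | h := eq_or_ne (B + r) A
  · obtain rfl : B = A - r := eq_sub_of_add_eq h
    simp
  · simp [h, mt eq_sub_iff_add_eq.1 h]

theorem isFrameIsometry_of_mem_bcMaps (κ : ℝ) {T : (BCSlot → G) → BCSlot → G}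
    (hT : T ∈ bcMaps G) : IsFrameIsometry (bcCoupling κ 0) T := by
  obtain ⟨h, u, rfl⟩ := hT
  refine ⟨1, fun _ => rfl, fun x => ⟨Sum.elim (fun p => if p.2 then (u p.1 * h true)⁻¹ else
    (x (.inr ()) * u p.1 * (x (.inr ()))⁻¹ * h false)⁻¹) 1, ?_⟩⟩
  rintro (⟨j, b⟩ | _) hA y
  · funext B
    obtain rfl | hB := eq_or_ne B (.inl (j, b))
    · cases b <;> simp [bcMap, mul_assoc]
    · rcases B with ⟨i, b'⟩ | _
      · cases b' <;> simp_all [bcMap]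
      · simp [bcMap]
  · simp [bcCoupling] at hA

end Isometry

/-! ## The polarized Lagrangian and the field operator -/

section LocalForm

variable {G : Type*} [Group G] {N d : ℕ} {ι : Type*} [Fintype ι] [DecidableEq ι]
  {ρ : G →* Matrix (Fin N) (Fin N) ℂ} (Q : InvariantMetric ρ d) (κ : ι → ℝ) (m : ℝ)

/-- The bilinear form `κ ∇u · ∇v + m u v` whose value at `(φ̄, φ)` is the local Lagrangian. -/
def localForm (u v : (ι → G) → ℂ) (x : ι → G) : ℂ :=
  (∑ A, (κ A : ℂ) * ∑ a, frameDeriv Q A a u x * frameDeriv Q A a v x) + (m : ℂ) * (u x * v x)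

/-- The Klein–Gordon operator `κ Δ - m` of the local Lagrangian. -/
def fieldOperator (u : (ι → G) → ℂ) (x : ι → G) : ℂ :=
  (∑ A, (κ A : ℂ) * ∑ a, frameDeriv Q A a (frameDeriv Q A a u) x) - (m : ℂ) * u x

theorem localLagrangian_eq_sum_localForm {C : Type*} [Fintype C] (φ : C → (ι → G) → ℂ) :
    localLagrangian Q κ m φ =
      fun x => ∑ c, localForm Q κ m (fun y => conj (φ c y)) (φ c) x := rfl

theorem localForm_comm (u v : (ι → G) → ℂ) : localForm Q κ m u v = localForm Q κ m v u := by
  funext x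
  simp only [localForm, mul_comm (frameDeriv Q _ _ u x), mul_comm (u x)]

theorem localForm_conj (u v : (ι → G) → ℂ) (x : ι → G) :
    localForm Q κ m (fun y => conj (u y)) (fun y => conj (v y)) x =
      conj (localForm Q κ m u v x) := by
  simp [localForm, frameDeriv_conj]

theorem fieldOperator_conj (u : (ι → G) → ℂ) (x : ι → G) :
    fieldOperator Q κ m (fun y => conj (u y)) x = conj (fieldOperator Q κ m u x) := by
  simp [fieldOperator, funext (frameDeriv_conj Q _ _ _), frameDeriv_conj]

variable {u v w : (ι → G) → ℂ}

theorem IsSmooth.localForm (hu : IsSmooth ρ u) (hv : IsSmooth ρ v) :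
    IsSmooth ρ (localForm Q κ m u v) :=
  .add (.sum fun A _ => (IsSmooth.sum fun a _ =>
    (hu.frameDeriv Q A a).mul (hv.frameDeriv Q A a)).const_mul _) ((hu.mul hv).const_mul _)

theorem IsSmooth.fieldOperator (hu : IsSmooth ρ u) : IsSmooth ρ (fieldOperator Q κ m u) :=
  SmoothAlong.sub
    (IsSmooth.sum fun A _ => (IsSmooth.sum fun a _ =>
      (hu.frameDeriv Q A a).frameDeriv Q A a).const_mul _) (hu.const_mul _)

theorem localForm_linear_right (u : (ι → G) → ℂ) (hv : IsSmooth ρ v) (hw : IsSmooth ρ w)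
    (z z' : ℂ) (x : ι → G) :
    localForm Q κ m u (fun y => z * v y + z' * w y) x =
      z * localForm Q κ m u v x + z' * localForm Q κ m u w x := by
  have hframe (A a) : frameDeriv Q A a (fun y => z * v y + z' * w y) x =
      z * frameDeriv Q A a v x + z' * frameDeriv Q A a w x := by
    simp only [frameDeriv_eq_lieDeriv, ← lieDeriv_const_mul]
    exact (isSmoothFamily_rightFlow A (Q.e a)).lieDeriv_add (hv.const_mul z)
      (hw.const_mul z') x
  simp only [localForm, hframe, mul_add, mul_sum, sum_add_distrib]
  simp only [mul_left_comm _ z, mul_left_comm _ z']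
  ring

theorem localForm_linear_left (hu : IsSmooth ρ u) (hw : IsSmooth ρ w) (v : (ι → G) → ℂ)
    (z z' : ℂ) (x : ι → G) :
    localForm Q κ m (fun y => z * u y + z' * w y) v x =
      z * localForm Q κ m u v x + z' * localForm Q κ m w v x := by
  simp only [localForm_comm Q κ m _ v, localForm_linear_right Q κ m v hu hw]

/-! ### Invariance under isometries -/

theorem InvariantMetric.sum_adjoint_mul_sum_adjoint_mul (g : G) (s : Fin d → Fin d → ℂ) :
    ∑ a, ∑ b, (Q.B (velocity ρ ((Q.e a).conjBy g)) (velocity ρ (Q.e b)) : ℂ) *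
      ∑ c, (Q.B (velocity ρ ((Q.e a).conjBy g)) (velocity ρ (Q.e c)) : ℂ) * s b c =
        ∑ b, s b b := by
  simp only [mul_sum, ← mul_assoc]
  rw [sum_comm]
  refine sum_congr rfl fun b _ => ?_
  rw [sum_comm]
  simp only [← sum_mul]
  simp [← Complex.ofReal_mul, ← Complex.ofReal_sum, Q.adjoint_orthogonal, apply_ite Complex.ofReal]

theorem sum_lieDeriv_conjBy_mul (A : ι) (g : G) (hu : IsSmooth ρ u) (hv : IsSmooth ρ v)
    (x : ι → G) :
    ∑ a, lieDeriv (rightFlow A ((Q.e a).conjBy g)) u x *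
        lieDeriv (rightFlow A ((Q.e a).conjBy g)) v x =
      ∑ a, frameDeriv Q A a u x * frameDeriv Q A a v x := by
  rw [← Q.sum_adjoint_mul_sum_adjoint_mul g fun b c => frameDeriv Q A b u x * frameDeriv Q A c v x]
  refine sum_congr rfl fun a _ => ?_
  rw [lieDeriv_rightFlow_eq_sum Q A _ hu, lieDeriv_rightFlow_eq_sum Q A _ hv, sum_mul]
  refine sum_congr rfl fun b _ => ?_
  rw [mul_assoc, mul_sum]
  simp only [mul_left_comm]

theorem sum_lieDeriv_lieDeriv_conjBy (A : ι) (g : G) (hu : IsSmooth ρ u) (x : ι → G) :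
    ∑ a, lieDeriv (rightFlow A ((Q.e a).conjBy g))
        (lieDeriv (rightFlow A ((Q.e a).conjBy g)) u) x =
      ∑ a, frameDeriv Q A a (frameDeriv Q A a u) x := by
  rw [← Q.sum_adjoint_mul_sum_adjoint_mul g fun b c => frameDeriv Q A b (frameDeriv Q A c u) x]
  refine sum_congr rfl fun a _ => ?_
  rw [lieDeriv_rightFlow_eq_sum Q A _ ((isSmoothFamily_rightFlow A _).isSmooth_lieDeriv hu)]
  refine sum_congr rfl fun b _ => congrArg _ ?_
  rw [funext (lieDeriv_rightFlow_eq_sum Q A ((Q.e a).conjBy g) hu), frameDeriv_eq_lieDeriv,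
    (isSmoothFamily_rightFlow A _).lieDeriv_sum fun c _ => (hu.frameDeriv Q A c).const_mul _]
  simp only [lieDeriv_const_mul, frameDeriv_eq_lieDeriv]

variable {Q κ m} {T : (ι → G) → ι → G}

theorem IsFrameIsometry.localForm_comp (hT : IsFrameIsometry κ T) (hu : IsSmooth ρ u)
    (hv : IsSmooth ρ v) (x : ι → G) :
    localForm Q κ m (u ∘ T) (v ∘ T) x = localForm Q κ m u v (T x) := by
  obtain ⟨π, hπ, hT⟩ := hT
  obtain ⟨g, hg⟩ := hT x
  refine congrArg (· + _) ((sum_congr rfl fun A _ => ?_).trans (Equiv.sum_comp π fun B =>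
    (κ B : ℂ) * ∑ b, frameDeriv Q B b u (T x) * frameDeriv Q B b v (T x)))
  obtain h0 | hA := eq_or_ne (κ A) 0
  · simp [hπ, h0]
  · simp only [hπ, frameDeriv_eq_lieDeriv, (hg A hA).lieDeriv_comp]
    rw [sum_lieDeriv_conjBy_mul Q (π A) (g A) hu hv]
    simp only [frameDeriv_eq_lieDeriv]

theorem IsFrameIsometry.fieldOperator_comp (hT : IsFrameIsometry κ T) (hu : IsSmooth ρ u)
    (x : ι → G) : fieldOperator Q κ m (u ∘ T) x = fieldOperator Q κ m u (T x) := by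
  obtain ⟨π, hπ, hT⟩ := hT
  obtain ⟨g, hg⟩ := hT x
  refine congrArg (· - _) ((sum_congr rfl fun A _ => ?_).trans (Equiv.sum_comp π fun B =>
    (κ B : ℂ) * ∑ b, frameDeriv Q B b (frameDeriv Q B b u) (T x)))
  obtain h0 | hA := eq_or_ne (κ A) 0
  · simp [hπ, h0]
  · simp only [hπ, frameDeriv_eq_lieDeriv, (hg A hA).lieDeriv_lieDeriv_comp]
    rw [sum_lieDeriv_lieDeriv_conjBy Q (π A) (g A) hu]
    simp only [frameDeriv_eq_lieDeriv]

theorem lieDeriv_localForm (α β : ι → OneParam ρ) (hu : IsSmooth ρ u) (hv : IsSmooth ρ v)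
    (x : ι → G) :
    lieDeriv (biFlow α β) (localForm Q κ m u v) x =
      localForm Q κ m (lieDeriv (biFlow α β) u) v x +
        localForm Q κ m u (lieDeriv (biFlow α β) v) x := by
  have hΦ := isSmoothFamily_biFlow α β
  have hframe (A a) {u : (ι → G) → ℂ} (hu : IsSmooth ρ u) :
      HasDerivAt (fun t => frameDeriv Q A a (u ∘ biFlow α β t) x)
        (frameDeriv Q A a (lieDeriv (biFlow α β) u) x) 0 :=
    hΦ.hasDerivAt_lieDeriv_comp (isSmoothFamily_rightFlow A (Q.e a)) hu x
  have hzero (w : (ι → G) → ℂ) : w ∘ biFlow α β 0 = w := funext fun y => congrArg w (hΦ.zero y)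
  have hderiv := (HasDerivAt.fun_sum (u := univ) fun A _ =>
    (HasDerivAt.fun_sum (u := univ) fun a _ =>
      (hframe A a hu).fun_mul (hframe A a hv)).const_mul (κ A : ℂ)).add
    (((hΦ.hasDerivAt hu x).fun_mul (hΦ.hasDerivAt hv x)).const_mul (m : ℂ))
  simp only [hzero, hΦ.zero] at hderiv
  calc lieDeriv (biFlow α β) (localForm Q κ m u v) x
      = deriv (fun t => localForm Q κ m (u ∘ biFlow α β t) (v ∘ biFlow α β t) x) 0 :=
        congrArg (deriv · 0) (funext fun t =>
          ((isFrameIsometry_biFlow κ α β t).localForm_comp hu hv x).symm)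
    _ = _ := hderiv.deriv
    _ = _ := by
        simp only [localForm, sum_add_distrib, mul_add]
        ring

end LocalForm

/-! ## Divergence of the Noether current -/

section Divergence

variable {G : Type*} [Group G] {N d : ℕ} {ι : Type*} [Fintype ι] {C : Type*}
  {ρ : G →* Matrix (Fin N) (Fin N) ℂ}

theorem characteristic_biFlow {φ : C → (ι → G) → ℂ} (α β : ι → OneParam ρ) {c : C}
    (hφ : IsSmooth ρ (φ c)) (θ : C → ℝ) :
    characteristic (biFlow α β) θ φ c =
      fun x => Complex.I * θ c * φ c x + (-1) * lieDeriv (biFlow α β) (φ c) x := by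
  funext x
  have hphase :
      HasDerivAt (fun t : ℝ => Complex.exp (Complex.I * t * θ c)) (Complex.I * θ c) 0 := by
    simpa using ((((hasDerivAt_id (0 : ℝ)).ofReal_comp).const_mul Complex.I).mul_const
      (θ c : ℂ)).cexp
  have hflow : HasDerivAt (fun t : ℝ => φ c (biFlow α β (-t) x))
      (-lieDeriv (biFlow α β) (φ c) x) 0 := by
    have h : HasDerivAt (fun t => φ c (biFlow α β t x)) (lieDeriv (biFlow α β) (φ c) x) (-0) := by
      simpa using (isSmoothFamily_biFlow α β).hasDerivAt hφ x
    simpa [Function.comp_def] using h.scomp (0 : ℝ) (hasDerivAt_neg 0)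
  rw [characteristic, (hphase.fun_mul hflow).deriv]
  simp [(isSmoothFamily_biFlow α β).zero]

theorem isSmooth_characteristic {φ : C → (ι → G) → ℂ} (α β : ι → OneParam ρ) {c : C}
    (hφ : IsSmooth ρ (φ c)) (θ : C → ℝ) :
    IsSmooth ρ (characteristic (biFlow α β) θ φ c) := by
  rw [characteristic_biFlow α β hφ]
  exact (hφ.const_mul _).add (((isSmoothFamily_biFlow α β).isSmooth_lieDeriv hφ).const_mul _)

variable [DecidableEq ι] (Q : InvariantMetric ρ d) (κ : ι → ℝ) (m : ℝ)
  {u v : (ι → G) → ℂ}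

theorem divergence_add {J J' : ι → Fin d → (ι → G) → ℂ} (hJ : ∀ A a, IsSmooth ρ (J A a))
    (hJ' : ∀ A a, IsSmooth ρ (J' A a)) (x : ι → G) :
    divergence Q (fun A a y => J A a y + J' A a y) x = divergence Q J x + divergence Q J' x := by
  simp only [divergence, ← sum_add_distrib]
  exact sum_congr rfl fun A _ => sum_congr rfl fun a _ =>
    (isSmoothFamily_rightFlow A (Q.e a)).lieDeriv_add (hJ A a) (hJ' A a) x

theorem divergence_sum {s : Finset C} {J : C → ι → Fin d → (ι → G) → ℂ}
    (hJ : ∀ c A a, IsSmooth ρ (J c A a)) (x : ι → G) :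
    divergence Q (fun A a y => ∑ c ∈ s, J c A a y) x = ∑ c ∈ s, divergence Q (J c) x := by
  have hframe (A a) : frameDeriv Q A a (fun y => ∑ c ∈ s, J c A a y) x =
      ∑ c ∈ s, frameDeriv Q A a (J c A a) x :=
    (isSmoothFamily_rightFlow A (Q.e a)).lieDeriv_sum (fun c _ => hJ c A a) x
  simp only [divergence, hframe]
  exact (sum_congr rfl fun _ _ => sum_comm).trans sum_comm

theorem divergence_gradient_mul (hu : IsSmooth ρ u) (hv : IsSmooth ρ v) (x : ι → G) :
    divergence Q (fun A a y => (κ A : ℂ) * (frameDeriv Q A a u y * v y)) x =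
      fieldOperator Q κ m u x * v x + localForm Q κ m u v x := by
  have hframe (A a) : frameDeriv Q A a (fun y => (κ A : ℂ) * (frameDeriv Q A a u y * v y)) x =
      (κ A : ℂ) * (frameDeriv Q A a (frameDeriv Q A a u) x * v x +
        frameDeriv Q A a u x * frameDeriv Q A a v x) :=
    (lieDeriv_const_mul _ _ _ x).trans (congrArg _
      ((isSmoothFamily_rightFlow A (Q.e a)).lieDeriv_mul (hu.frameDeriv Q A a) hv x))
  simp only [divergence, hframe, fieldOperator, localForm, ← mul_sum, sum_add_distrib, ← sum_mul,
    mul_add, sub_mul]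
  simp only [sum_mul, mul_assoc]
  ring

theorem divergence_add_mul_generatorComponent (α β : ι → OneParam ρ)
    {J : ι → Fin d → (ι → G) → ℂ} (hJ : ∀ A a, IsSmooth ρ (J A a)) (hu : IsSmooth ρ u)
    (x : ι → G) :
    divergence Q (fun A a y => J A a y + u y * (generatorComponent Q (biFlow α β) A a y : ℂ)) x =
      divergence Q J x + lieDeriv (biFlow α β) u x := by
  rw [lieDeriv_biFlow_eq_sum Q α β hu]
  simp only [divergence, ← sum_add_distrib]
  refine sum_congr rfl fun A _ => sum_congr rfl fun a _ => ?_
  -- `generatorComponent` is constant along the orbits of `E_(A,a)`, since `Ad` fixes `e a` there.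
  have hJA := (isSmoothFamily_rightFlow A (Q.e a)).hasDerivAt (hJ A a) x
  have huA := (isSmoothFamily_rightFlow A (Q.e a)).hasDerivAt hu x
  rw [mul_comm _ (frameDeriv Q A a u x)]
  refine HasDerivAt.deriv <|
    (hJA.add (huA.mul_const _)).congr_of_eventuallyEq (.of_forall fun t => ?_)
  exact congrArg (fun r : ℝ => J A a (rightFlow A (Q.e a) t x) + u (rightFlow A (Q.e a) t x) * r)
    (generatorComponent_rightFlow Q α β A a t x)

variable {φ : C → (ι → G) → ℂ} (α β : ι → OneParam ρ)

theorem lieDeriv_localForm_eq_neg {c : C} (hφ : IsSmooth ρ (φ c)) (θ : C → ℝ) (x : ι → G) :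
    lieDeriv (biFlow α β) (localForm Q κ m (fun y => conj (φ c y)) (φ c)) x =
      -(localForm Q κ m (φ c) (fun y => conj (characteristic (biFlow α β) θ φ c y)) x +
        localForm Q κ m (fun y => conj (φ c y)) (characteristic (biFlow α β) θ φ c) x) := by
  have hX := (isSmoothFamily_biFlow α β).isSmooth_lieDeriv hφ
  rw [lieDeriv_localForm α β (hφ.conj) hφ, characteristic_biFlow α β hφ,
    localForm_linear_right Q κ m _ hφ hX]
  simp only [map_add, map_mul, Complex.conj_I, Complex.conj_ofReal, map_neg, map_one]
  rw [localForm_linear_right Q κ m _ (hφ.conj) hX.conj,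
    funext (lieDeriv_conj (biFlow α β) (φ c)), localForm_comm Q κ m (φ c),
    localForm_comm Q κ m (φ c)]
  ring

variable [Fintype C]

theorem current_eq_sum_gradient_mul (φ : C → (ι → G) → ℂ) (Φ : ℝ → (ι → G) → (ι → G))
    (θ : C → ℝ) :
    current Q κ m φ Φ θ = fun A a x =>
      ∑ c, ((κ A : ℂ) * (frameDeriv Q A a (φ c) x * conj (characteristic Φ θ φ c x)) +
        (κ A : ℂ) * (frameDeriv Q A a (fun y => conj (φ c y)) x * characteristic Φ θ φ c x)) +
      (∑ c, localForm Q κ m (fun y => conj (φ c y)) (φ c) x) *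
        (generatorComponent Q Φ A a x : ℂ) := by
  funext A a x
  simp only [current, mul_sum, mul_add, localLagrangian_eq_sum_localForm]

theorem divergence_current (hφ : ∀ c, IsSmooth ρ (φ c)) (θ : C → ℝ) (x : ι → G) :
    divergence Q (current Q κ m φ (biFlow α β) θ) x =
      ((2 * ∑ c, (fieldOperator Q κ m (φ c) x *
        conj (characteristic (biFlow α β) θ φ c x)).re : ℝ) : ℂ) := by
  have hφ' (c) : IsSmooth ρ fun y => conj (φ c y) := (hφ c).conj
  have hX (c) := isSmooth_characteristic α β (hφ c) θ
  have hX' (c) : IsSmooth ρ fun y => conj (characteristic (biFlow α β) θ φ c y) :=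
    (hX c).conj
  have hgrad {u v : (ι → G) → ℂ} (hu : IsSmooth ρ u) (hv : IsSmooth ρ v) (A : ι) (a : Fin d) :
      IsSmooth ρ fun y => (κ A : ℂ) * (frameDeriv Q A a u y * v y) :=
    ((hu.frameDeriv Q A a).mul hv).const_mul _
  have hL (c) : IsSmooth ρ (localForm Q κ m (fun y => conj (φ c y)) (φ c)) :=
    (hφ' c).localForm Q κ m (hφ c)
  have hgrad₂ (c A a) := (hgrad (hφ c) (hX' c) A a).add (hgrad (hφ' c) (hX c) A a)
  rw [current_eq_sum_gradient_mul,
    divergence_add_mul_generatorComponent Q α β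
      (fun A a => IsSmooth.sum fun c _ => hgrad₂ c A a) (IsSmooth.sum fun c _ => hL c),
    divergence_sum Q hgrad₂,
    (isSmoothFamily_biFlow α β).lieDeriv_sum fun c _ => hL c, ← sum_add_distrib]
  push_cast
  rw [mul_sum]
  refine sum_congr rfl fun c _ => ?_
  rw [divergence_add Q (hgrad (hφ c) (hX' c)) (hgrad (hφ' c) (hX c)),
    divergence_gradient_mul Q κ m (hφ c) (hX' c), divergence_gradient_mul Q κ m (hφ' c) (hX c),
    fieldOperator_conj, lieDeriv_localForm_eq_neg Q κ m α β (hφ c) θ]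
  have hre := Complex.add_conj
    (fieldOperator Q κ m (φ c) x * conj (characteristic (biFlow α β) θ φ c x))
  rw [map_mul, Complex.conj_conj] at hre
  push_cast at hre
  rw [← hre]
  ring

theorem current_zero_trivialFlow (φ : C → (ι → G) → ℂ) (θ : C → ℝ) :
    current Q 0 m φ trivialFlow θ = 0 := by
  funext A a x
  simp [current, generatorComponent, trivialFlow, (HasVelocity.const _).velocity_eq]

end Divergence

/-! ## Compact groups of matrices -/

section Topology

variable {G : Type*} [Group G] [TopologicalSpace G] {N : ℕ} {ι : Type*}
  {ρ : G →* Matrix (Fin N) (Fin N) ℂ}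

theorem continuous_matEmb (hρ : Continuous ρ) : Continuous (matEmb ρ : (ι → G) → _) :=
  continuous_pi fun A => continuous_pi fun i => continuous_pi fun j =>
    (continuous_apply_apply i j).comp (hρ.comp (continuous_apply A))

theorem IsSmooth.continuous [Fintype ι] (hρ : Continuous ρ) {u : (ι → G) → ℂ}
    (hu : IsSmooth ρ u) : Continuous u :=
  SmoothAlong.continuous (continuous_matEmb hρ) hu

theorem SmoothAlong.det {X E : Type*} [NormedAddCommGroup E] [NormedSpace ℝ E] {r : X → E} {n : ℕ}
    {M : X → Matrix (Fin n) (Fin n) ℂ} (hM : ∀ i j, SmoothAlong r fun x => M x i j) :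
    SmoothAlong r fun x => (M x).det := by
  simp only [Matrix.det_apply']
  exact .sum fun σ _ => (SmoothAlong.const _ _).mul (.prod fun i _ => hM _ _)

variable [CompactSpace G]

theorem secondCountableTopology_of_injective (hρ : Continuous ρ) (hinj : Function.Injective ρ) :
    SecondCountableTopology G :=
  have : SecondCountableTopology (Matrix (Fin N) (Fin N) ℂ) :=
    inferInstanceAs (SecondCountableTopology (Fin N → Fin N → ℂ))
  (hρ.isClosedEmbedding hinj).isEmbedding.secondCountableTopology

theorem norm_le_one_of_continuous {K : Type*} [NormedDivisionRing K] {χ : G →* K}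
    (hχ : Continuous χ) (g : G) : ‖χ g‖ ≤ 1 := by
  by_contra! h
  obtain ⟨b, hb⟩ := (isCompact_range hχ.norm).bddAbove
  obtain ⟨n, hn⟩ := pow_unbounded_of_one_lt b h
  have hle : ‖χ (g ^ n)‖ ≤ b := hb ⟨g ^ n, rfl⟩
  rw [map_pow, norm_pow] at hle
  exact hle.not_gt hn

theorem norm_eq_one_of_continuous {K : Type*} [NormedDivisionRing K] {χ : G →* K}
    (hχ : Continuous χ) (g : G) : ‖χ g‖ = 1 := by
  have hmul : ‖χ g‖ * ‖χ g⁻¹‖ = 1 := by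
    rw [← norm_mul, ← map_mul, mul_inv_cancel, map_one, norm_one]
  refine (norm_le_one_of_continuous hχ g).antisymm ?_
  rw [← hmul]
  exact mul_le_of_le_one_right (norm_nonneg _) (norm_le_one_of_continuous hχ g⁻¹)

theorem map_inv_eq_conj_det_smul_adjugate (hρ : Continuous ρ) (g : G) :
    ρ g⁻¹ = conj (ρ g).det • (ρ g).adjugate := by
  have hnorm : ‖(ρ g).det‖ = 1 :=
    norm_eq_one_of_continuous (χ := Matrix.detMonoidHom.comp ρ) hρ.matrix_det g
  have hdet : conj (ρ g).det * (ρ g).det = 1 := by simp [Complex.conj_mul', hnorm]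
  have hinv : ρ g⁻¹ * ρ g = 1 := by rw [← map_mul, inv_mul_cancel, map_one]
  calc ρ g⁻¹ = conj (ρ g).det • (ρ g).det • ρ g⁻¹ := by rw [smul_smul, hdet, one_smul]
    _ = conj (ρ g).det • (ρ g⁻¹ * (ρ g * (ρ g).adjugate)) := by
        rw [Matrix.mul_adjugate, mul_smul_comm, mul_one]
    _ = conj (ρ g).det • (ρ g).adjugate := by rw [← mul_assoc, hinv, one_mul]

theorem SmoothGroup.inv (hρ : Continuous ρ) {X E : Type*} [NormedAddCommGroup E] [NormedSpace ℝ E]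
    {r : X → E} {c : X → G} (hc : SmoothGroup ρ r c) : SmoothGroup ρ r fun x => (c x)⁻¹ := by
  intro i j
  simp only [map_inv_eq_conj_det_smul_adjugate hρ, Matrix.smul_apply, smul_eq_mul,
    Matrix.adjugate_apply]
  refine (SmoothAlong.det hc).conj.mul (.det fun k l => ?_)
  obtain rfl | hk := eq_or_ne k j
  · simpa using SmoothAlong.const _ _
  · simpa [Matrix.updateRow_ne hk] using hc k l

end Topology

/-! ## Integration by parts -/

section Integration

variable {G : Type*} [Group G] [TopologicalSpace G] [CompactSpace G] [MeasurableSpace G]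
  [BorelSpace G] {N d : ℕ} {ι : Type*} [Fintype ι] {ρ : G →* Matrix (Fin N) (Fin N) ℂ}
  {u v : (ι → G) → ℂ}

theorem IsSmooth.integrable [SecondCountableTopology G] (μ : Measure G) [IsProbabilityMeasure μ]
    (hρ : Continuous ρ) (hu : IsSmooth ρ u) : Integrable u (Measure.pi fun _ => μ) :=
  integrable_of_continuous (hu.continuous hρ)

theorem integral_comp_of_measurePreserving {X Y E : Type*} [MeasurableSpace X] [TopologicalSpace Y]
    [MeasurableSpace Y] [OpensMeasurableSpace Y] [NormedAddCommGroup E] [NormedSpace ℝ E]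
    [SecondCountableTopologyEither Y E] {ν : Measure X} {ν' : Measure Y} {T : X → Y}
    (hT : MeasurePreserving T ν ν') {u : Y → E} (hu : Continuous u) :
    ∫ x, u (T x) ∂ν = ∫ y, u y ∂ν' := by
  rw [← hT.map_eq, integral_map hT.measurable.aemeasurable hu.aestronglyMeasurable]

theorem IsSmoothFamily.integral_lieDeriv_eq_zero {Φ : ℝ → (ι → G) → (ι → G)}
    [SecondCountableTopology G] (μ : Measure G) [IsProbabilityMeasure μ]
    (hΦ : IsSmoothFamily ρ Φ) (hρ : Continuous ρ)
    (hμ : ∀ t, MeasurePreserving (Φ t) (Measure.pi fun _ => μ) (Measure.pi fun _ => μ))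
    (hu : IsSmooth ρ u) : ∫ x, lieDeriv Φ u x ∂Measure.pi (fun _ => μ) = 0 := by
  have h := SmoothAlong.hasDerivAt_integral (ν := Measure.pi fun _ => μ)
    (u := fun t x => u (Φ t x)) (continuous_matEmb hρ) (hΦ.smoothAlong_comp hu) 0
  simp only [integral_comp_of_measurePreserving (hμ _) (hu.continuous hρ)] at h
  exact h.unique (hasDerivAt_const _ _)

variable [IsTopologicalGroup G]

theorem isMulRightInvariant_of_compactSpace (μ : Measure G) [μ.IsHaarMeasure]
    [IsProbabilityMeasure μ] : μ.IsMulRightInvariant where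
  map_mul_right_eq_self g :=
    have : IsProbabilityMeasure (μ.map (· * g)) :=
      Measure.isProbabilityMeasure_map (measurable_mul_const g).aemeasurable
    Measure.isHaarMeasure_eq_of_isProbabilityMeasure _ _

variable (μ : Measure G) [μ.IsHaarMeasure] [IsProbabilityMeasure μ]

theorem measurePreserving_mul_mul (p q : ι → G) :
    MeasurePreserving (fun (x : ι → G) A => p A * x A * q A)
      (Measure.pi fun _ => μ) (Measure.pi fun _ => μ) := by
  have := isMulRightInvariant_of_compactSpace μ
  exact measurePreserving_pi (fun _ => μ) (fun _ => μ) fun A =>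
    (measurePreserving_mul_right μ (q A)).comp (measurePreserving_mul_left μ (p A))

theorem measurePreserving_rightFlow [DecidableEq ι] (A : ι) (δ : OneParam ρ) (t : ℝ) :
    MeasurePreserving (rightFlow A δ t) (Measure.pi fun _ => μ) (Measure.pi fun _ => μ) := by
  convert measurePreserving_mul_mul μ 1 (Pi.mulSingle A (δ t)) using 1
  funext x B
  obtain rfl | h := eq_or_ne B A <;> simp [rightFlow, *]

variable [SecondCountableTopology G] [DecidableEq ι] (Q : InvariantMetric ρ d)

theorem integral_divergence (hρ : Continuous ρ) {J : ι → Fin d → (ι → G) → ℂ}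
    (hJ : ∀ A a, IsSmooth ρ (J A a)) :
    ∫ x, divergence Q J x ∂Measure.pi (fun _ => μ) = 0 := by
  simp only [divergence]
  rw [integral_finsetSum _ fun A _ => IsSmooth.integrable μ hρ <|
    IsSmooth.sum fun a _ => (hJ A a).frameDeriv Q A a]
  refine sum_eq_zero fun A _ => ?_
  rw [integral_finsetSum _ fun a _ => ((hJ A a).frameDeriv Q A a).integrable μ hρ]
  exact sum_eq_zero fun a _ => (isSmoothFamily_rightFlow A (Q.e a)).integral_lieDeriv_eq_zero μ hρ
    (measurePreserving_rightFlow μ A (Q.e a)) (hJ A a)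

theorem integral_localForm (hρ : Continuous ρ) (κ : ι → ℝ) (m : ℝ) (hu : IsSmooth ρ u)
    (hv : IsSmooth ρ v) :
    ∫ x, localForm Q κ m u v x ∂Measure.pi (fun _ => μ) =
      -∫ x, fieldOperator Q κ m u x * v x ∂Measure.pi (fun _ => μ) := by
  have h := integral_divergence μ Q hρ fun A a =>
    ((hu.frameDeriv Q A a).mul hv).const_mul (κ A : ℂ)
  simp only [divergence_gradient_mul Q κ m hu hv] at h
  rw [integral_add (((hu.fieldOperator Q κ m).mul hv).integrable μ hρ)
    ((hu.localForm Q κ m hv).integrable μ hρ)] at h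
  exact eq_neg_of_add_eq_zero_right h

end Integration

/-! ## The field equation -/

section FieldEquation

section Pairing

variable {G ι C : Type*} [Fintype ι] [MeasurableSpace G] (μ : Measure G) [Fintype C]

/-- The bilinear pairing `∑_c ∫ η^c I^c` of a variation `η` with a functional gradient `I`. -/
def pairing (η I : C → (ι → G) → ℂ) : ℂ :=
  ∑ c, ∫ x, η c x * I c x ∂Measure.pi fun _ => μ

theorem eq_zero_of_re_pairing_conj_self_eq_zero [TopologicalSpace G] [CompactSpace G]
    [BorelSpace G] [SecondCountableTopology G] [IsProbabilityMeasure μ] [μ.IsOpenPosMeasure]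
    {J : C → (ι → G) → ℂ} (hJ : ∀ c, Continuous (J c))
    (h : (pairing μ (fun c x => conj (J c x)) J).re = 0) (c : C) : J c = 0 := by
  have hpairing : pairing μ (fun c x => conj (J c x)) J =
      ((∑ c, ∫ x, ‖J c x‖ ^ 2 ∂Measure.pi (fun _ => μ) : ℝ) : ℂ) := by
    push_cast [pairing, Complex.conj_mul', ← integral_complex_ofReal]
    rfl
  rw [hpairing, Complex.ofReal_re, sum_eq_zero_iff_of_nonneg fun c _ =>
    integral_nonneg fun x => by positivity] at h
  have hcont : Continuous fun x => ‖J c x‖ ^ 2 := (hJ c).norm.pow 2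
  have hae := h c (mem_univ c)
  rw [integral_eq_zero_iff_of_nonneg (fun x => by positivity)
    (integrable_of_continuous hcont)] at hae
  funext x
  have hx : ‖J c x‖ ^ 2 = 0 :=
    congrFun ((Continuous.ae_eq_iff_eq _ hcont continuous_zero).1 hae) x
  simpa using hx

end Pairing

theorem lieDeriv_trivialFlow {G ι : Type*} (u : (ι → G) → ℂ) (x : ι → G) :
    lieDeriv trivialFlow u x = 0 := by
  simp [lieDeriv, trivialFlow]

variable {G : Type*} [Group G] {N d : ℕ} {ι C : Type*} [Fintype ι]
  {ρ : G →* Matrix (Fin N) (Fin N) ℂ}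

theorem localForm_conj_add_mul [DecidableEq ι] (Q : InvariantMetric ρ d) (κ : ι → ℝ) (m : ℝ)
    {u v : (ι → G) → ℂ} (hu : IsSmooth ρ u) (hv : IsSmooth ρ v) (s : ℝ) (x : ι → G) :
    localForm Q κ m (fun y => conj (u y + s * v y)) (fun y => u y + s * v y) x =
      localForm Q κ m (fun y => conj (u y)) u x +
        s * (localForm Q κ m (fun y => conj (u y)) v x +
          conj (localForm Q κ m (fun y => conj (u y)) v x)) +
        s ^ 2 * localForm Q κ m (fun y => conj (v y)) v x := by
  have hright (w) := localForm_linear_right Q κ m w hu hv 1 s x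
  have hleft (w) := localForm_linear_left Q κ m hu.conj hv.conj w 1 s x
  simp only [one_mul] at hright hleft
  simp only [map_add, map_mul, Complex.conj_ofReal, hleft, hright, ← localForm_conj,
    Complex.conj_conj]
  rw [localForm_comm Q κ m u]
  ring

theorem pairing_const_mul_sub [TopologicalSpace G] [CompactSpace G] [MeasurableSpace G]
    [BorelSpace G] [SecondCountableTopology G] (μ : Measure G) [IsProbabilityMeasure μ]
    [Fintype C] (hρ : Continuous ρ) {η I J : C → (ι → G) → ℂ}
    (hη : ∀ c, IsSmooth ρ (η c)) (hI : ∀ c, IsSmooth ρ (I c)) (hJ : ∀ c, IsSmooth ρ (J c))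
    (z : ℂ) :
    pairing μ η (fun c x => z * I c x - J c x) = z * pairing μ η I - pairing μ η J := by
  simp only [pairing, mul_sum, ← sum_sub_distrib, mul_sub, mul_left_comm _ z]
  refine sum_congr rfl fun c _ => ?_
  rw [integral_sub ((((hη c).mul (hI c)).const_mul z).integrable μ hρ)
    (((hη c).mul (hJ c)).integrable μ hρ), integral_const_mul]

variable [DecidableEq ι] (Q : InvariantMetric ρ d) (κ : ι → ℝ) (m l : ℝ)

/-- The Euler–Lagrange equations `κ Δ φ^c - m φ^c = l Ī^c`, in which `l I^c` is the holomorphic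
derivative of the interaction with respect to `φ^c`. -/
def SolvesFieldEquation (φ I : C → (ι → G) → ℂ) : Prop :=
  ∀ c x, fieldOperator Q κ m (φ c) x = l * conj (I c x)

section Stationarity

variable [TopologicalSpace G] [IsTopologicalGroup G] [CompactSpace G] [MeasurableSpace G]
  [BorelSpace G] [SecondCountableTopology G] (μ : Measure G) [μ.IsHaarMeasure]
  [IsProbabilityMeasure μ] [Fintype C] {Q κ m l}

theorem hasDerivAt_localAction (hρ : Continuous ρ) {φ η : C → (ι → G) → ℂ}
    (hφ : ∀ c, IsSmooth ρ (φ c)) (hη : ∀ c, IsSmooth ρ (η c)) :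
    HasDerivAt (fun s : ℝ => localAction μ Q κ m fun c x => φ c x + (s : ℂ) * η c x)
      (-(pairing μ η (fun c x => conj (fieldOperator Q κ m (φ c) x)) +
        conj (pairing μ η fun c x => conj (fieldOperator Q κ m (φ c) x)))) 0 := by
  set D : (ι → G) → ℂ := fun x => ∑ c, localForm Q κ m (fun y => conj (φ c y)) (η c) x
  have hD : IsSmooth ρ D := .sum fun c _ => (hφ c).conj.localForm Q κ m (hη c)
  have hL {u : C → (ι → G) → ℂ} (hu : ∀ c, IsSmooth ρ (u c)) :
      IsSmooth ρ (localLagrangian Q κ m u) :=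
    IsSmooth.sum fun c _ => (hu c).conj.localForm Q κ m (hu c)
  have hDint : ∫ x, D x ∂Measure.pi (fun _ => μ) =
      -pairing μ η (fun c x => conj (fieldOperator Q κ m (φ c) x)) := by
    rw [integral_finsetSum _ fun c _ => ((hφ c).conj.localForm Q κ m (hη c)).integrable μ hρ,
      pairing, ← sum_neg_distrib]
    simp only [integral_localForm μ Q hρ κ m (hφ _).conj (hη _), fieldOperator_conj, mul_comm]
  have hquad (s : ℝ) : localAction μ Q κ m (fun c x => φ c x + (s : ℂ) * η c x) =
      localAction μ Q κ m φ + s * (∫ x, D x ∂Measure.pi (fun _ => μ) +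
        conj (∫ x, D x ∂Measure.pi (fun _ => μ))) + s ^ 2 * localAction μ Q κ m η := by
    have hpoint (x) : localLagrangian Q κ m (fun c x => φ c x + (s : ℂ) * η c x) x =
        localLagrangian Q κ m φ x + s * (D x + conj (D x)) +
          s ^ 2 * localLagrangian Q κ m η x := by
      simp only [localLagrangian_eq_sum_localForm, localForm_conj_add_mul Q κ m (hφ _) (hη _), D,
        sum_add_distrib, mul_sum, map_sum, mul_add]
    have hsD := (hD.add hD.conj).const_mul (s : ℂ)
    simp only [localAction, hpoint]
    rw [integral_add (((hL hφ).add hsD).integrable μ hρ)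
        (((hL hη).const_mul ((s : ℂ) ^ 2)).integrable μ hρ),
      integral_add ((hL hφ).integrable μ hρ) (hsD.integrable μ hρ), integral_const_mul,
      integral_const_mul, integral_add (hD.integrable μ hρ) (hD.conj.integrable μ hρ),
      integral_conj]
  simp only [hquad, hDint]
  have hs : HasDerivAt (fun s : ℝ => (s : ℂ)) 1 0 := (hasDerivAt_id (0 : ℝ)).ofReal_comp
  refine (((hs.mul_const _).const_add _).fun_add ((hs.fun_pow 2).mul_const _)).congr_deriv ?_
  simp [add_comm]

theorem solvesFieldEquation_of_isStationary (hρ : Continuous ρ)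
    {𝒯 : Set ((ι → G) → (ι → G))} (h𝒯 : ∀ T ∈ 𝒯, IsFrameIsometry κ T)
    {φ I : C → (ι → G) → ℂ} {S : (C → (ι → G) → ℂ) → ℂ}
    (hφ : φ ∈ fields ρ C 𝒯) (hI : I ∈ fields ρ C 𝒯)
    (hS : ∀ η ∈ fields ρ C 𝒯, HasDerivAt (fun s : ℝ => S fun c x => φ c x + (s : ℂ) * η c x)
      (l * pairing μ η I + conj (l * pairing μ η I)) 0)
    (hstat : IsStationary (fun φ => localAction μ Q κ m φ + S φ) (fields ρ C 𝒯) φ) :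
    SolvesFieldEquation Q κ m l φ I := by
  set F : C → (ι → G) → ℂ := fun c x => conj (fieldOperator Q κ m (φ c) x) with hF
  set J : C → (ι → G) → ℂ := fun c x => l * I c x - F c x with hJ
  have hFs (c) : IsSmooth ρ (F c) := ((hφ c).1.fieldOperator Q κ m).conj
  have hJs (c) : IsSmooth ρ (J c) := SmoothAlong.sub ((hI c).1.const_mul l) (hFs c)
  have hJT (c) (T) (hT : T ∈ 𝒯) (x) : J c (T x) = J c x := by
    have hopT := (h𝒯 T hT).fieldOperator_comp (Q := Q) (m := m) (hφ c).1 x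
    rw [(hφ c).2 T hT] at hopT
    have hIT : I c (T x) = I c x := congrFun ((hI c).2 T hT) x
    simp only [hJ, hF, hIT, hopT]
  have hmem : (fun c x => conj (J c x)) ∈ fields ρ C 𝒯 := fun c =>
    ⟨(hJs c).conj, fun T hT => funext fun x => congrArg conj (hJT c T hT x)⟩
  have hzero := ((hasDerivAt_localAction μ hρ (fun c => (hφ c).1) fun c =>
    (hJs c).conj).fun_add (hS _ hmem)).unique (hstat _ hmem)
  have hre : (pairing μ (fun c x => conj (J c x)) J).re = 0 := by
    rw [hJ, pairing_const_mul_sub μ hρ (fun c => (hJs c).conj) (fun c => (hI c).1) hFs]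
    have := congrArg Complex.re hzero
    simp only [Complex.add_re, Complex.neg_re, Complex.conj_re, Complex.zero_re,
      Complex.sub_re] at this ⊢
    linarith
  intro c x
  have hJ0 : l * I c x = F c x := sub_eq_zero.1 <| congrFun
    (eq_zero_of_re_pairing_conj_self_eq_zero μ (fun c => (hJs c).continuous hρ) hre c) x
  simpa [hF] using (congrArg conj hJ0).symm

end Stationarity

namespace SolvesFieldEquation

variable [Fintype C] {Q κ m l} {φ I : C → (ι → G) → ℂ} (h : SolvesFieldEquation Q κ m l φ I)
  (hφ : ∀ c, IsSmooth ρ (φ c))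
include h hφ

theorem divergence_current (α β : ι → OneParam ρ) (θ : C → ℝ) (x : ι → G) :
    divergence Q (current Q κ m φ (biFlow α β) θ) x =
      ((-2 * l * ∑ c, ((lieDeriv (biFlow α β) (φ c) x * I c x).re +
        θ c * (φ c x * I c x).im) : ℝ) : ℂ) := by
  rw [GFT.divergence_current Q κ m α β hφ]
  congr 1
  simp only [mul_sum]
  refine sum_congr rfl fun c _ => ?_
  rw [h, characteristic_biFlow α β (hφ c)]
  simp
  ring

theorem divergence_current_flow (α β : ι → OneParam ρ) (x : ι → G) :
    divergence Q (current Q κ m φ (biFlow α β) 0) x =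
      ((-2 * l * ∑ c, (lieDeriv (biFlow α β) (φ c) x * I c x).re : ℝ) : ℂ) := by
  simp only [h.divergence_current hφ, Pi.zero_apply, zero_mul, add_zero]

theorem divergence_current_phase (θ : C → ℝ) (x : ι → G) :
    divergence Q (current Q κ m φ trivialFlow θ) x =
      ((-2 * l * ∑ c, θ c * (φ c x * I c x).im : ℝ) : ℂ) := by
  rw [trivialFlow_eq_biFlow ρ, h.divergence_current hφ, ← trivialFlow_eq_biFlow ρ]
  simp only [lieDeriv_trivialFlow, zero_mul, Complex.zero_re, zero_add]

end SolvesFieldEquation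

end FieldEquation

/-! ## Integrals with an omitted factor -/

section Extend

variable {G ι ε : Type*} {f : ι → ε}

theorem extend_comp_perm (hf : Function.Injective f) (τ : Equiv.Perm ε) (π : Equiv.Perm ι)
    (x : ι → G) (g : ε → G) :
    Function.extend (τ ∘ f ∘ π) (x ∘ π) g ∘ τ = Function.extend f x (g ∘ τ) := by
  have hinj : Function.Injective (τ ∘ f ∘ π) := τ.injective.comp (hf.comp π.injective)
  funext e
  by_cases he : ∃ A, f A = e
  · obtain ⟨A, rfl⟩ := he
    simpa [hf.extend_apply] using hinj.extend_apply (x ∘ π) g (π.symm A)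
  · have he' : ¬∃ A, (τ ∘ f ∘ π) A = τ e := fun ⟨A, hA⟩ => he ⟨π A, τ.injective hA⟩
    rw [Function.comp_apply, Function.extend_apply' _ _ _ he, Function.extend_apply' _ _ _ he']
    rfl

theorem extend_mul_mul [Mul G] (hf : Function.Injective f) (p q : ε → G) (x : ι → G) (g : ε → G) :
    Function.extend f (fun A => p (f A) * x A * q (f A)) (fun e => p e * g e * q e) =
      fun e => p e * Function.extend f x g e * q e := by
  funext e
  by_cases he : ∃ A, f A = e
  · obtain ⟨A, rfl⟩ := he
    simp only [hf.extend_apply]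
  · simp only [Function.extend_apply' _ _ _ he]

open scoped Classical in
theorem preimage_extend_pi (hf : Function.Injective f) (s : ε → Set G) :
    (fun p : (ι → G) × (ε → G) => Function.extend f p.1 p.2) ⁻¹' Set.univ.pi s =
      (Set.univ.pi fun A => s (f A)) ×ˢ
        Set.univ.pi fun e => if e ∈ Set.range f then Set.univ else s e := by
  ext p
  simp only [Set.mem_preimage, Set.mem_univ_pi, Set.mem_prod]
  refine ⟨fun h => ⟨fun A => by simpa [hf.extend_apply] using h (f A), fun e => ?_⟩,
    fun ⟨h₁, h₂⟩ e => ?_⟩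
  · by_cases he : e ∈ Set.range f
    · simp [he]
    · simpa [he, Function.extend_apply' _ _ _ he] using h e
  · by_cases he : e ∈ Set.range f
    · obtain ⟨A, rfl⟩ := he
      simpa [hf.extend_apply] using h₁ A
    · simpa [he, Function.extend_apply' _ _ _ he] using h₂ e

variable [MeasurableSpace G]

theorem measurable_extend (hf : Function.Injective f) :
    Measurable fun p : (ι → G) × (ε → G) => Function.extend f p.1 p.2 := by
  refine measurable_pi_lambda _ fun e => ?_
  by_cases h : ∃ A, f A = e
  · obtain ⟨A, rfl⟩ := h
    simp only [hf.extend_apply]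
    fun_prop
  · simp only [Function.extend_apply' _ _ _ h]
    fun_prop

variable [Fintype ι] [Fintype ε] (μ : Measure G) [IsProbabilityMeasure μ]

theorem measurePreserving_extend (hf : Function.Injective f) :
    MeasurePreserving (fun p : (ι → G) × (ε → G) => Function.extend f p.1 p.2)
      ((Measure.pi fun _ => μ).prod (Measure.pi fun _ => μ)) (Measure.pi fun _ => μ) := by
  classical
  refine ⟨measurable_extend hf, (Measure.pi_eq fun s hs => ?_).symm⟩
  have hrange : ∏ A, μ (s (f A)) = ∏ e, if e ∈ Set.range f then μ (s e) else 1 := by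
    rw [← prod_filter, ← prod_image (f := fun e => μ (s e)) fun a _ b _ h => hf h]
    congr 1
    ext e
    simp
  rw [Measure.map_apply (measurable_extend hf) (.univ_pi hs), preimage_extend_pi hf,
    Measure.prod_prod, Measure.pi_pi, Measure.pi_pi, hrange, ← prod_mul_distrib]
  refine prod_congr rfl fun e _ => ?_
  split_ifs <;> simp

theorem integral_comp_perm (τ : Equiv.Perm ε) (F : (ε → G) → ℂ) :
    ∫ g, F (g ∘ τ) ∂Measure.pi (fun _ => μ) = ∫ g, F g ∂Measure.pi fun _ => μ := by
  have h : MeasurePreserving (MeasurableEquiv.arrowCongr' τ.symm (MeasurableEquiv.refl G))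
      (Measure.pi fun _ : ε => μ) (Measure.pi fun _ => μ) :=
    measurePreserving_arrowCongr' _ _ _ _ fun _ => .id μ
  exact h.integral_comp' F

theorem integral_comp_mul_mul [Group G] [TopologicalSpace G] [IsTopologicalGroup G]
    [CompactSpace G] [BorelSpace G] [μ.IsHaarMeasure] (p q : ε → G) (F : (ε → G) → ℂ) :
    ∫ g, F (fun e => p e * g e * q e) ∂Measure.pi (fun _ => μ) =
      ∫ g, F g ∂Measure.pi fun _ => μ :=
  (measurePreserving_mul_mul μ p q).integral_comp' (f := MeasurableEquiv.piCongrRight fun e =>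
    (MeasurableEquiv.mulLeft (p e)).trans (MeasurableEquiv.mulRight (q e))) F

end Extend

section OmitIntegral

variable {G : Type*} [MeasurableSpace G] {ι V ε : Type*} [Fintype V] [DecidableEq V] [Fintype ε]
  (μ : Measure G) {f : V → ι → ε} {ψ : V → (ι → G) → ℂ} {v : V}

theorem omitIntegral_conj (f : V → ι → ε) (ψ : V → (ι → G) → ℂ) (v : V) (x : ι → G) :
    omitIntegral μ f (fun w y => conj (ψ w y)) v x = conj (omitIntegral μ f ψ v x) := by
  simp only [omitIntegral, ← integral_conj, map_prod]

variable [IsProbabilityMeasure μ]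

theorem omitIntegral_comp_perm {σ : Equiv.Perm V} {τ : Equiv.Perm ε} {π : V → Equiv.Perm ι}
    (h : ∀ w, f (σ w) = τ ∘ f w ∘ π w) {ψ' : V → (ι → G) → ℂ}
    (hψ : ∀ w y, ψ (σ w) (y ∘ π w) = ψ' w y) (hf : Function.Injective (f v)) (x : ι → G) :
    omitIntegral μ f ψ (σ v) (x ∘ π v) = omitIntegral μ f ψ' v x := by
  simp only [omitIntegral]
  rw [← integral_comp_perm μ τ fun g => ∏ w ∈ univ.erase v, ψ' w (Function.extend (f v) x g ∘ f w)]
  refine integral_congr_ae (.of_forall fun g => (prod_equiv σ (by simp) fun w _ => ?_).symm)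
  rw [← hψ w, ← extend_comp_perm hf τ (π v), h v, h w]
  rfl

variable [Group G] [TopologicalSpace G] [IsTopologicalGroup G] [CompactSpace G] [BorelSpace G]
  [μ.IsHaarMeasure]

theorem omitIntegral_mul_mul (p q : ε → G)
    (hψ : ∀ w y, ψ w (fun A => p (f w A) * y A * q (f w A)) = ψ w y)
    (hf : Function.Injective (f v)) (x : ι → G) :
    omitIntegral μ f ψ v (fun A => p (f v A) * x A * q (f v A)) = omitIntegral μ f ψ v x := by
  simp only [omitIntegral]
  rw [← integral_comp_mul_mul μ p q]
  simp only [extend_mul_mul hf]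
  exact integral_congr_ae (.of_forall fun g => prod_congr rfl fun w _ => hψ w _)

theorem omitIntegral_comp_of_mem_gaugeMaps {T : (ι → G) → (ι → G)}
    (hT : T ∈ gaugeMaps G ι) (hψ : ∀ w, ψ w ∘ T = ψ w) (hf : Function.Injective (f v)) :
    omitIntegral μ f ψ v ∘ T = omitIntegral μ f ψ v := by
  obtain ⟨h, rfl⟩ := hT
  funext x
  simpa using omitIntegral_mul_mul μ (f := f) (fun _ => 1) (fun _ => h)
    (fun w y => by simpa using congrFun (hψ w) y) hf x

end OmitIntegral

section Interaction

theorem deriv_prod_add_mul {V : Type*} [Fintype V] [DecidableEq V] (a b : V → ℂ) :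
    deriv (fun s : ℝ => ∏ v, (a v + s * b v)) 0 = ∑ v, b v * ∏ w ∈ univ.erase v, a w := by
  have hs : HasDerivAt (fun s : ℝ => (s : ℂ)) 1 0 := (hasDerivAt_id (0 : ℝ)).ofReal_comp
  have h := HasDerivAt.fun_finsetProd (u := univ) fun v _ => (hs.mul_const (b v)).const_add (a v)
  rw [h.deriv]
  simp [mul_comm]

variable {G : Type*} [Group G] {N : ℕ} {ι V ε : Type*} {ρ : G →* Matrix (Fin N) (Fin N) ℂ}
  {f : V → ι → ε} {ψ : V → (ι → G) → ℂ} {v : V}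

theorem smoothGroup_extend [Fintype ι] [Fintype ε] {f : ι → ε} (hf : Function.Injective f) (e : ε) :
    SmoothGroup ρ (Prod.map (matEmb ρ) (matEmb ρ))
      fun p : (ι → G) × (ε → G) => Function.extend f p.1 p.2 e := by
  by_cases h : ∃ A, f A = e
  · obtain ⟨A, rfl⟩ := h
    simp only [hf.extend_apply]
    exact fun i j => (smoothGroup_apply ρ A i j).comp_fst _
  · simp only [Function.extend_apply' _ _ _ h]
    exact fun i j => (smoothGroup_apply ρ e i j).comp_snd _

theorem continuous_mul_prod_erase [TopologicalSpace G] [Fintype ι] [Fintype V] [DecidableEq V]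
    (hρ : Continuous ρ) (hψ : ∀ w, IsSmooth ρ (ψ w))
    {η : (ι → G) → ℂ} (hη : IsSmooth ρ η) (f : V → ι → ε) (v : V) :
    Continuous fun g : ε → G => η (g ∘ f v) * ∏ w ∈ univ.erase v, ψ w (g ∘ f w) :=
  ((hη.continuous hρ).comp (by fun_prop)).mul <|
    continuous_finsetProd _ fun w _ => ((hψ w).continuous hρ).comp (by fun_prop)

variable [Fintype ι] [Fintype V] [DecidableEq V] [Fintype ε]

theorem smoothAlong_prod_extend (hψ : ∀ w, IsSmooth ρ (ψ w)) (hf : Function.Injective (f v)) :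
    SmoothAlong (Prod.map (matEmb ρ) (matEmb ρ)) fun p : (ι → G) × (ε → G) =>
      ∏ w ∈ univ.erase v, ψ w (Function.extend (f v) p.1 p.2 ∘ f w) :=
  .prod fun w _ => (hψ w).comp_smoothGroup fun A => smoothGroup_extend hf (f w A)

variable [TopologicalSpace G] [CompactSpace G] [MeasurableSpace G] [BorelSpace G]
  [SecondCountableTopology G] (μ : Measure G) [IsProbabilityMeasure μ]

theorem isSmooth_omitIntegral (hρ : Continuous ρ) (hψ : ∀ w, IsSmooth ρ (ψ w))
    (hf : Function.Injective (f v)) : IsSmooth ρ (omitIntegral μ f ψ v) :=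
  SmoothAlong.integral (continuous_matEmb hρ) (smoothAlong_prod_extend hψ hf)

theorem integral_mul_prod_erase (hρ : Continuous ρ) (hψ : ∀ w, IsSmooth ρ (ψ w))
    {η : (ι → G) → ℂ} (hη : IsSmooth ρ η) (hf : Function.Injective (f v)) :
    ∫ g : ε → G, η (g ∘ f v) * ∏ w ∈ univ.erase v, ψ w (g ∘ f w) ∂Measure.pi (fun _ => μ) =
      ∫ x, η x * omitIntegral μ f ψ v x ∂Measure.pi (fun _ => μ) := by
  have hcont : Continuous fun p : (ι → G) × (ε → G) =>
      η p.1 * ∏ w ∈ univ.erase v, ψ w (Function.extend (f v) p.1 p.2 ∘ f w) :=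
    ((hη.continuous hρ).comp continuous_fst).mul <| (smoothAlong_prod_extend hψ hf).continuous <|
      (continuous_matEmb hρ).prodMap (continuous_matEmb hρ)
  rw [← integral_comp_of_measurePreserving (measurePreserving_extend μ hf)
    (continuous_mul_prod_erase hρ hψ hη f v)]
  simp only [Function.extend_comp hf]
  rw [integral_prod _ (integrable_of_continuous hcont)]
  simp only [omitIntegral, integral_const_mul]

theorem hasDerivAt_interaction (hρ : Continuous ρ) (hf : ∀ v, Function.Injective (f v))
    (hψ : ∀ v, IsSmooth ρ (ψ v)) {η : V → (ι → G) → ℂ} (hη : ∀ v, IsSmooth ρ (η v)) :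
    HasDerivAt (fun s : ℝ => interaction μ f fun v x => ψ v x + (s : ℂ) * η v x)
      (pairing μ η (omitIntegral μ f ψ)) 0 := by
  have hs : SmoothAlong (Prod.map id (matEmb ρ)) fun p : ℝ × (ε → G) => (p.1 : ℂ) :=
    ((SmoothAlong.self id).contDiff_comp Complex.ofRealCLM.contDiff).comp_fst _
  have hcomp {u : (ι → G) → ℂ} (hu : IsSmooth ρ u) (v : V) :
      SmoothAlong (Prod.map id (matEmb ρ)) fun p : ℝ × (ε → G) => u (p.2 ∘ f v) :=
    (hu.comp_smoothGroup fun A => smoothGroup_apply ρ (f v A)).comp_snd id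
  have h := SmoothAlong.hasDerivAt_integral (ν := Measure.pi fun _ : ε => μ)
    (u := fun s g => ∏ v, (ψ v (g ∘ f v) + (s : ℂ) * η v (g ∘ f v))) (continuous_matEmb hρ)
    (.prod fun v _ => (hcomp (hψ v) v).add (hs.mul (hcomp (hη v) v))) 0
  refine h.congr_deriv ?_
  simp only [deriv_prod_add_mul]
  rw [integral_finsetSum _ fun v _ =>
    integrable_of_continuous (continuous_mul_prod_erase hρ hψ (hη v) f v)]
  exact sum_congr rfl fun v _ => integral_mul_prod_erase μ hρ hψ (hη v) (hf v)

end Interaction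

/-! ## Field equations of the non-local models -/

section FieldEquation

variable {G : Type*} [MeasurableSpace G] (μ : Measure G) {N d : ℕ} {ι V ε C : Type*} [Fintype V]
  [DecidableEq V] [Fintype ε] [DecidableEq C]

/-- The functional gradient `δ/δφ^c` of the interaction: the sum of the `omitIntegral`s over the
factors `v` of color `c`. -/
def interactionGradient (f : V → ι → ε) (col : V → C) (φ : C → (ι → G) → ℂ) (c : C)
    (x : ι → G) : ℂ :=
  ∑ v with col v = c, omitIntegral μ f (fun v => φ (col v)) v x

theorem interactionGradient_id (f : V → ι → ε) (φ : V → (ι → G) → ℂ) :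
    interactionGradient μ f id φ = omitIntegral μ f φ := by
  funext c x
  simp [interactionGradient, sum_filter]

theorem interactionGradient_unit (f : V → ι → ε) (φ : Unit → (ι → G) → ℂ) :
    interactionGradient μ f (fun _ => ()) φ =
      fun _ x => ∑ v, omitIntegral μ f (fun _ => φ ()) v x := by
  funext c x
  simp [interactionGradient]

theorem interactionGradient_unit_of_forall_eq {f : V → ι → ε} {φ : Unit → (ι → G) → ℂ}
    {o : (ι → G) → ℂ} (ho : ∀ v, omitIntegral μ f (fun _ => φ ()) v = o) :
    interactionGradient μ f (fun _ => ()) φ = fun _ x => (Fintype.card V : ℝ) * o x := by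
  simp [interactionGradient_unit, ho]

variable [Group G] [TopologicalSpace G] [CompactSpace G] [BorelSpace G] [IsProbabilityMeasure μ]
  {f : V → ι → ε} {col : V → C} {φ : C → (ι → G) → ℂ}

theorem interactionGradient_comp_of_mem_gaugeMaps [IsTopologicalGroup G] [μ.IsHaarMeasure]
    {T : (ι → G) → (ι → G)} (hT : T ∈ gaugeMaps G ι) (hφ : ∀ c, φ c ∘ T = φ c)
    (hf : ∀ v, Function.Injective (f v)) (c : C) :
    interactionGradient μ f col φ c ∘ T = interactionGradient μ f col φ c :=
  funext fun x => sum_congr rfl fun v _ =>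
    congrFun (omitIntegral_comp_of_mem_gaugeMaps μ hT (fun w => hφ (col w)) (hf v)) x

variable [SecondCountableTopology G] [Fintype ι] {ρ : G →* Matrix (Fin N) (Fin N) ℂ}

theorem isSmooth_interactionGradient (hρ : Continuous ρ) (hf : ∀ v, Function.Injective (f v))
    (hφ : ∀ c, IsSmooth ρ (φ c)) (c : C) : IsSmooth ρ (interactionGradient μ f col φ c) :=
  .sum fun v _ => isSmooth_omitIntegral μ hρ (fun w => hφ (col w)) (hf v)

theorem pairing_interactionGradient [Fintype C] (hρ : Continuous ρ)
    (hf : ∀ v, Function.Injective (f v)) (hφ : ∀ c, IsSmooth ρ (φ c)) {η : C → (ι → G) → ℂ}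
    (hη : ∀ c, IsSmooth ρ (η c)) :
    pairing μ η (interactionGradient μ f col φ) =
      pairing μ (fun v => η (col v)) (omitIntegral μ f fun v => φ (col v)) := by
  simp only [pairing, interactionGradient, mul_sum]
  rw [← sum_fiberwise univ col]
  refine sum_congr rfl fun c _ => ?_
  rw [integral_finsetSum _ fun v _ => ((hη c).mul
    (isSmooth_omitIntegral μ hρ (fun w => hφ (col w)) (hf v))).integrable μ hρ]
  refine sum_congr rfl fun v hv => ?_
  rw [(mem_filter.1 hv).2]

variable [IsTopologicalGroup G] [μ.IsHaarMeasure]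

theorem interactionGradient_mem_fields (hρ : Continuous ρ) (hf : ∀ v, Function.Injective (f v))
    {𝒯 : Set ((ι → G) → (ι → G))} (h𝒯 : 𝒯 ⊆ gaugeMaps G ι) (hφ : φ ∈ fields ρ C 𝒯) :
    interactionGradient μ f col φ ∈ fields ρ C 𝒯 := fun c =>
  ⟨isSmooth_interactionGradient μ hρ hf (fun c => (hφ c).1) c, fun T hT =>
    interactionGradient_comp_of_mem_gaugeMaps μ (h𝒯 hT) (fun c => (hφ c).2 T hT) hf c⟩

variable [Fintype C] [DecidableEq ι] {Q : InvariantMetric ρ d} {κ : ι → ℝ} {m l : ℝ}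

theorem solvesFieldEquation_of_isStationary_action (hρ : Continuous ρ)
    (hf : ∀ v, Function.Injective (f v)) {𝒯 : Set ((ι → G) → (ι → G))}
    (h𝒯 : ∀ T ∈ 𝒯, IsFrameIsometry κ T) (hφ : φ ∈ fields ρ C 𝒯) {I : C → (ι → G) → ℂ}
    (hI : I ∈ fields ρ C 𝒯)
    (hpair : ∀ η ∈ fields ρ C 𝒯,
      pairing μ η (interactionGradient μ f col φ) = pairing μ η I)
    (hstat : IsStationary (action μ Q κ m l f col) (fields ρ C 𝒯) φ) :
    SolvesFieldEquation Q κ m l φ I := by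
  refine solvesFieldEquation_of_isStationary μ (S := fun φ =>
    (l : ℂ) * interaction μ f (fun v => φ (col v)) +
      conj ((l : ℂ) * interaction μ f fun v => φ (col v))) hρ h𝒯 hφ hI (fun η hη => ?_) hstat
  rw [← hpair η hη, pairing_interactionGradient μ hρ hf (fun c => (hφ c).1) fun c => (hη c).1]
  have h := (hasDerivAt_interaction μ hρ hf (fun v => (hφ (col v)).1)
    fun v => (hη (col v)).1).const_mul (l : ℂ)
  exact h.add h.star

theorem solvesFieldEquation_of_subset_gaugeMaps (hρ : Continuous ρ)
    (hf : ∀ v, Function.Injective (f v)) {𝒯 : Set ((ι → G) → (ι → G))} (h𝒯 : 𝒯 ⊆ gaugeMaps G ι)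
    (hφ : φ ∈ fields ρ C 𝒯)
    (hstat : IsStationary (action μ Q κ m l f col) (fields ρ C 𝒯) φ) :
    SolvesFieldEquation Q κ m l φ (interactionGradient μ f col φ) :=
  solvesFieldEquation_of_isStationary_action μ hρ hf
    (fun _ hT => isFrameIsometry_of_mem_gaugeMaps κ (h𝒯 hT)) hφ
    (interactionGradient_mem_fields μ hρ hf h𝒯 hφ) (fun _ _ => rfl) hstat

end FieldEquation

/-! ## Symmetries of the interaction patterns -/

section Patterns

/-- The cyclic symmetry of the simplicial pattern, acting on the variables. -/
def simplicialPerm : Equiv.Perm (Fin 6) where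
  toFun := ![2, 3, 4, 1, 5, 0]
  invFun := ![5, 3, 0, 1, 2, 4]
  left_inv := by decide
  right_inv := by decide

/-- The cyclic symmetry of the Ooguri pattern, acting on the variables. -/
def ooguriPerm : Equiv.Perm (Fin 10) where
  toFun := ![3, 4, 5, 6, 2, 7, 8, 1, 9, 0]
  invFun := ![9, 7, 4, 0, 1, 2, 3, 5, 6, 8]
  left_inv := by decide
  right_inv := by decide

/-- Rotation of the Boulatov tetrahedron about the first of its four factors, acting on the
variables. -/
def boulatovRotation : Equiv.Perm (Fin 6) where
  toFun := ![1, 2, 0, 4, 5, 3]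
  invFun := ![2, 0, 1, 5, 3, 4]
  left_inv := by decide
  right_inv := by decide

/-- Rotation of the Boulatov tetrahedron about the first of its four factors, acting on the
factors. -/
def boulatovRotationFactor : Equiv.Perm (Fin 4) where
  toFun := ![0, 2, 3, 1]
  invFun := ![0, 3, 1, 2]
  left_inv := by decide
  right_inv := by decide

/-- Half-turn of the Boulatov tetrahedron, acting on the variables. -/
def boulatovHalfTurn : Equiv.Perm (Fin 6) where
  toFun := ![0, 3, 4, 1, 2, 5]
  invFun := ![0, 3, 4, 1, 2, 5]
  left_inv := by decide
  right_inv := by decide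

/-- Half-turn of the Boulatov tetrahedron, acting on the factors. -/
def boulatovHalfTurnFactor : Equiv.Perm (Fin 4) where
  toFun := ![1, 0, 3, 2]
  invFun := ![1, 0, 3, 2]
  left_inv := by decide
  right_inv := by decide

theorem coloredPattern_injective : ∀ v, Function.Injective (coloredPattern v) := by decide

theorem simplicialPattern_injective : ∀ v, Function.Injective (simplicialPattern v) := by decide

theorem boulatovPattern_injective : ∀ v, Function.Injective (boulatovPattern v) := by decide

theorem boulatovPattern'_injective : ∀ v, Function.Injective (boulatovPattern' v) := by decide

theorem ooguriPattern_injective : ∀ v, Function.Injective (ooguriPattern v) := by decide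

theorem bcPattern_injective (v : Fin 5) : Function.Injective (bcPattern v) :=
  ((ooguriPattern_injective v).prodMap Function.injective_id).sumMap
    (Function.injective_of_subsingleton _)

theorem simplicialPattern_succ : ∀ v, simplicialPattern (Equiv.addRight (1 : Fin 4) v) =
    simplicialPerm ∘ simplicialPattern v ∘ (1 : Equiv.Perm (Fin 3)) := by decide

theorem ooguriPattern_succ : ∀ v, ooguriPattern (Equiv.addRight (1 : Fin 5) v) =
    ooguriPerm ∘ ooguriPattern v ∘ (1 : Equiv.Perm (Fin 4)) := by decide

theorem bcPattern_succ (v : Fin 5) : bcPattern (Equiv.addRight (1 : Fin 5) v) =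
    Equiv.sumCongr (Equiv.prodCongr ooguriPerm (Equiv.refl Bool)) (Equiv.addRight (1 : Fin 5)) ∘
      bcPattern v ∘ (1 : Equiv.Perm BCSlot) := by
  funext A
  obtain ⟨j, s⟩ | _ := A
  · simpa [bcPattern] using congrFun (ooguriPattern_succ v) j
  · simp [bcPattern]

theorem boulatovPattern_rotation : ∀ v, boulatovPattern (boulatovRotationFactor v) =
    boulatovRotation ∘ boulatovPattern v ∘
      Equiv.addRight ((![2, 0, 0, 0] : Fin 4 → Fin 3) v) := by decide

theorem boulatovPattern_halfTurn : ∀ v, boulatovPattern (boulatovHalfTurnFactor v) =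
    boulatovHalfTurn ∘ boulatovPattern v ∘
      Equiv.addRight ((![0, 0, 1, 2] : Fin 4 → Fin 3) v) := by decide

end Patterns

section PatternIntegrals

variable {G : Type*} [MeasurableSpace G] (μ : Measure G) [IsProbabilityMeasure μ]

theorem omitIntegral_eq_zero_of_succ {ι ε : Type*} [Fintype ε] {n : ℕ}
    {f : Fin (n + 1) → ι → ε} {τ : Equiv.Perm ε}
    (h : ∀ v, f (Equiv.addRight (1 : Fin (n + 1)) v) = τ ∘ f v ∘ (1 : Equiv.Perm ι))
    (hf : ∀ v, Function.Injective (f v)) (u : (ι → G) → ℂ) (v : Fin (n + 1)) :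
    omitIntegral μ f (fun _ => u) v = omitIntegral μ f (fun _ => u) 0 := by
  have hsucc (w : Fin (n + 1)) :
      omitIntegral μ f (fun _ => u) (w + 1) = omitIntegral μ f (fun _ => u) w :=
    funext fun x => omitIntegral_comp_perm μ (σ := Equiv.addRight 1) (π := fun _ => 1)
      (ψ := fun _ => u) (ψ' := fun _ => u) h (fun _ _ => rfl) (hf w) x
  induction v using Fin.induction with
  | zero => rfl
  | succ i ih => rw [← ih, ← Fin.coeSucc_eq_succ, hsucc]

section Boulatov

variable {u : (Fin 3 → G) → ℂ} (hu : ∀ T ∈ cyclicMaps G, u ∘ T = u)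
include hu

theorem omitIntegral_boulatov_comp_perm {σ : Equiv.Perm (Fin 4)} {τ : Equiv.Perm (Fin 6)}
    {r : Fin 4 → Fin 3}
    (h : ∀ v, boulatovPattern (σ v) = τ ∘ boulatovPattern v ∘ Equiv.addRight (r v))
    (v : Fin 4) (x : Fin 3 → G) :
    omitIntegral μ boulatovPattern (fun _ => u) (σ v) (x ∘ Equiv.addRight (r v)) =
      omitIntegral μ boulatovPattern (fun _ => u) v x :=
  omitIntegral_comp_perm μ (π := fun v => Equiv.addRight (r v)) h
    (fun v y => congrFun (hu _ ⟨r v, rfl⟩) y) (boulatovPattern_injective v) x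

theorem omitIntegral_boulatov (v : Fin 4) :
    omitIntegral μ boulatovPattern (fun _ => u) v =
      omitIntegral μ boulatovPattern (fun _ => u) 0 := by
  have rotation := omitIntegral_boulatov_comp_perm μ hu boulatovPattern_rotation
  have h₁ : omitIntegral μ boulatovPattern (fun _ => u) 1 =
      omitIntegral μ boulatovPattern (fun _ => u) 0 :=
    funext fun x => by
      simpa [boulatovHalfTurnFactor] using
        omitIntegral_boulatov_comp_perm μ hu boulatovPattern_halfTurn 0 x
  have h₂ : omitIntegral μ boulatovPattern (fun _ => u) 2 =
      omitIntegral μ boulatovPattern (fun _ => u) 1 :=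
    funext fun x => by simpa [boulatovRotationFactor] using rotation 1 x
  have h₃ : omitIntegral μ boulatovPattern (fun _ => u) 3 =
      omitIntegral μ boulatovPattern (fun _ => u) 2 :=
    funext fun x => by simpa [boulatovRotationFactor] using rotation 2 x
  fin_cases v
  exacts [rfl, h₁, h₂.trans h₁, (h₃.trans h₂).trans h₁]

theorem omitIntegral_boulatov_comp_cyclic {T : (Fin 3 → G) → (Fin 3 → G)}
    (hT : T ∈ cyclicMaps G) : omitIntegral μ boulatovPattern (fun _ => u) 0 ∘ T =
      omitIntegral μ boulatovPattern (fun _ => u) 0 := by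
  have rotation (x) := omitIntegral_boulatov_comp_perm μ hu boulatovPattern_rotation 0 x
  obtain ⟨r, rfl⟩ := hT
  funext x
  fin_cases r
  · simp
  · have hx : (fun i => x (i + 1)) ∘ Equiv.addRight 2 = x :=
      funext fun i => congrArg x (by fin_cases i <;> rfl)
    have h := rotation fun i => x (i + 1)
    exact h.symm.trans (congrArg _ hx)
  · exact rotation x

end Boulatov

end PatternIntegrals

/-! ## Cyclic averages -/

section CyclicAverage

/-- The average over the cyclic permutations of the three arguments. -/
def cyclicAverage {G : Type*} (o : (Fin 3 → G) → ℂ) (x : Fin 3 → G) : ℂ :=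
  (1 / 3 : ℂ) * ∑ r : Fin 3, o fun i => x (i + r)

theorem cyclicAverage_comp_of_mem_cyclicMaps {G : Type*} (o : (Fin 3 → G) → ℂ)
    {T : (Fin 3 → G) → (Fin 3 → G)} (hT : T ∈ cyclicMaps G) :
    cyclicAverage o ∘ T = cyclicAverage o := by
  obtain ⟨s, rfl⟩ := hT
  funext x
  simp only [cyclicAverage, Function.comp_apply]
  rw [← Equiv.sum_comp (Equiv.addRight s) fun r => o fun i => x (i + r)]
  simp only [Equiv.coe_addRight, add_assoc]

variable {G : Type*} [Group G] {N : ℕ} {ρ : G →* Matrix (Fin N) (Fin N) ℂ} {o : (Fin 3 → G) → ℂ}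

theorem cyclicAverage_comp_of_mem_gaugeMaps {T : (Fin 3 → G) → (Fin 3 → G)}
    (hT : T ∈ gaugeMaps G (Fin 3)) (ho : o ∘ T = o) :
    cyclicAverage o ∘ T = cyclicAverage o := by
  obtain ⟨h, rfl⟩ := hT
  exact funext fun x => congrArg _ (sum_congr rfl fun r _ => congrFun ho fun i => x (i + r))

theorem IsSmooth.comp_addRight (ho : IsSmooth ρ o) (r : Fin 3) :
    IsSmooth ρ fun x => o fun i => x (i + r) :=
  ho.comp_smoothGroup fun A => smoothGroup_apply ρ (A + r)

theorem IsSmooth.cyclicAverage (ho : IsSmooth ρ o) : IsSmooth ρ (cyclicAverage o) :=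
  (IsSmooth.sum fun r _ => ho.comp_addRight r).const_mul _

theorem integral_mul_cyclicAverage [TopologicalSpace G] [CompactSpace G] [MeasurableSpace G]
    [BorelSpace G] [SecondCountableTopology G] (μ : Measure G) [IsProbabilityMeasure μ]
    (hρ : Continuous ρ) {η : (Fin 3 → G) → ℂ} (hη : IsSmooth ρ η)
    (hηc : ∀ T ∈ cyclicMaps G, η ∘ T = η) (ho : IsSmooth ρ o) :
    ∫ x, η x * GFT.cyclicAverage o x ∂Measure.pi (fun _ => μ) =
      ∫ x, η x * o x ∂Measure.pi (fun _ => μ) := by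
  have hterm (r : Fin 3) : ∫ x, η x * o (fun i => x (i + r)) ∂Measure.pi (fun _ => μ) =
      ∫ x, η x * o x ∂Measure.pi (fun _ => μ) := by
    rw [← integral_comp_perm μ (Equiv.addRight r) fun x => η x * o x]
    exact integral_congr_ae (.of_forall fun x =>
      congrArg (· * _) (congrFun (hηc _ ⟨r, rfl⟩) x).symm)
  have hsum (x) : η x * GFT.cyclicAverage o x = (1 / 3) * ∑ r, η x * o fun i => x (i + r) := by
    rw [GFT.cyclicAverage, ← mul_sum, mul_left_comm]
  simp only [hsum]
  rw [integral_const_mul,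
    integral_finsetSum _ fun r _ => (hη.mul (ho.comp_addRight r)).integrable μ hρ]
  simp [hterm]

end CyclicAverage

/-! ## Field equations of the models -/

section UnitField

variable {G : Type*} [Group G] {N d : ℕ} {ι : Type*} [Fintype ι] [DecidableEq ι]
  {ρ : G →* Matrix (Fin N) (Fin N) ℂ} {Q : InvariantMetric ρ d} {κ : ι → ℝ} {m l z : ℝ}
  {φ : Unit → (ι → G) → ℂ} {o : (ι → G) → ℂ}
  (h : SolvesFieldEquation Q κ m l φ fun _ x => (z : ℂ) * o x) (hφ : IsSmooth ρ (φ ()))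
include h hφ

theorem SolvesFieldEquation.divergence_current_flow_unit (α β : ι → OneParam ρ) (x : ι → G) :
    divergence Q (current Q κ m φ (biFlow α β) 0) x =
      ((-(2 * z) * l * (lieDeriv (biFlow α β) (φ ()) x * o x).re : ℝ) : ℂ) := by
  rw [h.divergence_current_flow fun _ => hφ]
  simp only [univ_unique, sum_singleton, PUnit.default_eq_unit, mul_left_comm _ (z : ℂ),
    Complex.re_ofReal_mul]
  ring_nf

theorem SolvesFieldEquation.divergence_current_phase_unit (θ : ℝ) (x : ι → G) :
    divergence Q (current Q κ m φ trivialFlow fun _ => θ) x =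
      ((-(2 * z) * l * θ * (φ () x * o x).im : ℝ) : ℂ) := by
  rw [h.divergence_current_phase fun _ => hφ]
  simp only [univ_unique, sum_singleton, PUnit.default_eq_unit, mul_left_comm _ (z : ℂ),
    Complex.im_ofReal_mul]
  ring_nf

end UnitField

theorem const_mul_mem_fields {G : Type*} [Group G] {N : ℕ} {ι C : Type*} [Fintype ι]
    {ρ : G →* Matrix (Fin N) (Fin N) ℂ} {𝒯 : Set ((ι → G) → (ι → G))} {o : (ι → G) → ℂ}
    (ho : IsSmooth ρ o) (hoT : ∀ T ∈ 𝒯, o ∘ T = o) (z : ℂ) :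
    (fun _ x => z * o x) ∈ fields ρ C 𝒯 := fun _ =>
  ⟨ho.const_mul z, fun T hT => funext fun x => congrArg (z * ·) (congrFun (hoT T hT) x)⟩

section Models

variable {G : Type*} [Group G] [TopologicalSpace G] [IsTopologicalGroup G] [CompactSpace G]
  [MeasurableSpace G] [BorelSpace G] [SecondCountableTopology G] (μ : Measure G)
  [μ.IsHaarMeasure] [IsProbabilityMeasure μ] {N d : ℕ} {ρ : G →* Matrix (Fin N) (Fin N) ℂ}
  {Q : InvariantMetric ρ d} {m l : ℝ}

theorem solvesFieldEquation_colored {κ : Fin 3 → ℝ} (hρ : Continuous ρ)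
    {𝒯 : Set ((Fin 3 → G) → (Fin 3 → G))} (h𝒯 : 𝒯 ⊆ gaugeMaps G (Fin 3))
    {φ : Fin 4 → (Fin 3 → G) → ℂ} (hφ : φ ∈ fields ρ (Fin 4) 𝒯)
    (hstat : IsStationary (action μ Q κ m l coloredPattern id) (fields ρ (Fin 4) 𝒯) φ) :
    SolvesFieldEquation Q κ m l φ (omitIntegral μ coloredPattern φ) := by
  simpa only [interactionGradient_id] using
    solvesFieldEquation_of_subset_gaugeMaps μ hρ coloredPattern_injective h𝒯 hφ hstat

theorem solvesFieldEquation_of_succ {ι ε : Type*} [Fintype ι] [DecidableEq ι] [Fintype ε] {n : ℕ}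
    {κ : ι → ℝ} (hρ : Continuous ρ) {f : Fin (n + 1) → ι → ε} {τ : Equiv.Perm ε}
    (hsucc : ∀ v, f (Equiv.addRight (1 : Fin (n + 1)) v) = τ ∘ f v ∘ (1 : Equiv.Perm ι))
    (hf : ∀ v, Function.Injective (f v)) {𝒯 : Set ((ι → G) → (ι → G))}
    (h𝒯 : 𝒯 ⊆ gaugeMaps G ι) {φ : Unit → (ι → G) → ℂ} (hφ : φ ∈ fields ρ Unit 𝒯)
    (hstat : IsStationary (action μ Q κ m l f fun _ => ()) (fields ρ Unit 𝒯) φ) :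
    SolvesFieldEquation Q κ m l φ
      fun _ x => ((n + 1 : ℕ) : ℝ) * omitIntegral μ f (fun _ => φ ()) 0 x := by
  have h := solvesFieldEquation_of_subset_gaugeMaps μ hρ hf h𝒯 hφ hstat
  rwa [interactionGradient_unit_of_forall_eq μ (omitIntegral_eq_zero_of_succ μ hsucc hf (φ ())),
    Fintype.card_fin] at h

section Boulatov

variable {κ : ℝ} (hρ : Continuous ρ) {𝒯 : Set ((Fin 3 → G) → (Fin 3 → G))}
  (hcyc : cyclicMaps G ⊆ 𝒯) (h𝒯 : 𝒯 ⊆ cyclicMaps G ∪ gaugeMaps G (Fin 3))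
  {φ : Unit → (Fin 3 → G) → ℂ} (hφ : φ ∈ fields ρ Unit 𝒯)
include hρ hcyc h𝒯 hφ

theorem solvesFieldEquation_boulatov
    (hstat : IsStationary (action μ Q (fun _ => κ) m l boulatovPattern fun _ => ())
      (fields ρ Unit 𝒯) φ) :
    SolvesFieldEquation Q (fun _ => κ) m l φ
      fun _ x => (4 : ℝ) * omitIntegral μ boulatovPattern (fun _ => φ ()) 0 x := by
  have hφc (T) (hT : T ∈ cyclicMaps G) : φ () ∘ T = φ () := (hφ ()).2 T (hcyc hT)
  have ho (T) (hT : T ∈ 𝒯) : omitIntegral μ boulatovPattern (fun _ => φ ()) 0 ∘ T =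
      omitIntegral μ boulatovPattern (fun _ => φ ()) 0 :=
    (h𝒯 hT).elim (omitIntegral_boulatov_comp_cyclic μ hφc) fun hT' =>
      omitIntegral_comp_of_mem_gaugeMaps μ hT' (fun _ => (hφ ()).2 T hT)
        (boulatovPattern_injective 0)
  have hgrad := interactionGradient_unit_of_forall_eq μ (omitIntegral_boulatov μ hφc)
  refine solvesFieldEquation_of_isStationary_action μ hρ boulatovPattern_injective
    (fun T hT => (h𝒯 hT).elim (isFrameIsometry_of_mem_cyclicMaps κ)
      (isFrameIsometry_of_mem_gaugeMaps fun _ => κ)) hφ (const_mul_mem_fields ?_ ho _)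
    (fun η _ => by rw [hgrad]; simp) hstat
  exact isSmooth_omitIntegral μ hρ (fun _ => (hφ ()).1) (boulatovPattern_injective 0)

theorem solvesFieldEquation_boulatov'
    (hstat : IsStationary (action μ Q (fun _ => κ) m l boulatovPattern' fun _ => ())
      (fields ρ Unit 𝒯) φ) :
    SolvesFieldEquation Q (fun _ => κ) m l φ fun _ => cyclicAverage
      fun x => ∑ v, omitIntegral μ boulatovPattern' (fun _ => φ ()) v x := by
  have hs := isSmooth_interactionGradient μ (col := fun _ => ()) hρ boulatovPattern'_injective
    (fun c => (hφ c).1)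
  have hg (T) (hT : T ∈ 𝒯) (hT' : T ∈ gaugeMaps G (Fin 3)) :=
    interactionGradient_comp_of_mem_gaugeMaps μ (col := fun _ => ()) hT'
      (fun c => (hφ c).2 T hT) boulatovPattern'_injective ()
  rw [interactionGradient_unit] at hs hg
  refine solvesFieldEquation_of_isStationary_action μ hρ boulatovPattern'_injective
    (fun T hT => (h𝒯 hT).elim (isFrameIsometry_of_mem_cyclicMaps κ)
      (isFrameIsometry_of_mem_gaugeMaps fun _ => κ)) hφ (fun _ => ⟨(hs ()).cyclicAverage,
    fun T hT => (h𝒯 hT).elim (cyclicAverage_comp_of_mem_cyclicMaps _)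
      fun hT' => cyclicAverage_comp_of_mem_gaugeMaps hT' (hg T hT hT')⟩) (fun η hη => ?_) hstat
  rw [interactionGradient_unit]
  exact sum_congr rfl fun c _ => (integral_mul_cyclicAverage μ hρ (hη c).1
    (fun T hT => (hη c).2 T (hcyc hT)) (hs c)).symm

end Boulatov

end Models

section Alternating

section Algebra

variable {G ι : Type*} (u : (ι → G) → ℂ)

theorem alternating_add_mul (w : (ι → G) → ℂ) (s : ℝ) :
    (alternating fun x => u x + (s : ℂ) * w x) =
      fun v x => alternating u v x + (s : ℂ) * alternating w v x := by
  funext v x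
  fin_cases v <;> simp [alternating]

theorem alternating_succ (v : Fin 4) :
    alternating u (v + 1) = fun x => conj (alternating u v x) := by
  fin_cases v <;> simp [alternating]

variable {u}

theorem alternating_comp {T : (ι → G) → (ι → G)} (h : u ∘ T = u) (v : Fin 4) :
    alternating u v ∘ T = alternating u v := by
  have h' (x) : u (T x) = u x := congrFun h x
  fin_cases v <;> funext x <;> simp [alternating, h']

theorem IsSmooth.alternating [Group G] [Fintype ι] {N : ℕ} {ρ : G →* Matrix (Fin N) (Fin N) ℂ}
    (hu : IsSmooth ρ u) (v : Fin 4) : IsSmooth ρ (alternating u v) := by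
  fin_cases v
  exacts [hu, hu.conj, hu, hu.conj]

theorem pairing_alternating [Fintype ι] [MeasurableSpace G] (μ : Measure G) (η o : (ι → G) → ℂ) :
    pairing μ (GFT.alternating η) (GFT.alternating o) =
      pairing μ (fun _ : Unit => η) (fun _ x => (2 : ℝ) * o x) +
        conj (pairing μ (fun _ : Unit => η) fun _ x => (2 : ℝ) * o x) := by
  have hconj : ∫ x, conj (η x) * conj (o x) ∂Measure.pi (fun _ => μ) =
      conj (∫ x, η x * o x ∂Measure.pi fun _ => μ) := by
    simp only [← map_mul, integral_conj]
  simp [pairing, GFT.alternating, Fin.sum_univ_four, mul_left_comm _ (2 : ℂ), integral_const_mul,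
    hconj, Complex.conj_ofNat]
  ring

end Algebra

variable {G : Type*} [MeasurableSpace G] (μ : Measure G) [IsProbabilityMeasure μ]

theorem omitIntegral_alternating (u : (Fin 3 → G) → ℂ) :
    omitIntegral μ simplicialPattern (alternating u) =
      alternating (omitIntegral μ simplicialPattern (alternating u) 0) := by
  have hsucc (v : Fin 4) : omitIntegral μ simplicialPattern (alternating u) (v + 1) =
      fun x => conj (omitIntegral μ simplicialPattern (alternating u) v x) := by
    simp only [← omitIntegral_conj]
    exact funext <| omitIntegral_comp_perm μ simplicialPattern_succ
      (fun w y => congrFun (alternating_succ u w) y) (simplicialPattern_injective v)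
  funext v
  induction v using Fin.induction with
  | zero => rfl
  | succ i ih => rw [← Fin.coeSucc_eq_succ, hsucc, alternating_succ, ih]

variable [Group G] [TopologicalSpace G] [IsTopologicalGroup G] [CompactSpace G] [BorelSpace G]
  [SecondCountableTopology G] [μ.IsHaarMeasure] {N d : ℕ} {ρ : G →* Matrix (Fin N) (Fin N) ℂ}
  {Q : InvariantMetric ρ d} {κ : Fin 3 → ℝ} {m l : ℝ}

theorem solvesFieldEquation_alternating (hρ : Continuous ρ)
    {𝒯 : Set ((Fin 3 → G) → (Fin 3 → G))} (h𝒯 : 𝒯 ⊆ gaugeMaps G (Fin 3))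
    {φ : Unit → (Fin 3 → G) → ℂ} (hφ : φ ∈ fields ρ Unit 𝒯)
    (hstat : IsStationary (alternatingAction μ Q κ m l simplicialPattern) (fields ρ Unit 𝒯) φ) :
    SolvesFieldEquation Q κ m l φ
      fun _ x => (2 : ℝ) * omitIntegral μ simplicialPattern (alternating (φ ())) 0 x := by
  have hsmooth {η : Unit → (Fin 3 → G) → ℂ} (hη : η ∈ fields ρ Unit 𝒯) (v : Fin 4) :
      IsSmooth ρ (alternating (η ()) v) := (hη ()).1.alternating v
  have ho : IsSmooth ρ (omitIntegral μ simplicialPattern (alternating (φ ())) 0) :=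
    isSmooth_omitIntegral μ hρ (hsmooth hφ) (simplicialPattern_injective 0)
  have hoT (T) (hT : T ∈ 𝒯) : omitIntegral μ simplicialPattern (alternating (φ ())) 0 ∘ T =
      omitIntegral μ simplicialPattern (alternating (φ ())) 0 :=
    omitIntegral_comp_of_mem_gaugeMaps μ (h𝒯 hT) (alternating_comp ((hφ ()).2 T hT))
      (simplicialPattern_injective 0)
  refine solvesFieldEquation_of_isStationary μ
    (S := fun φ => (l : ℂ) * interaction μ simplicialPattern (alternating (φ ()))) hρ
    (fun T hT => isFrameIsometry_of_mem_gaugeMaps κ (h𝒯 hT)) hφ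
    (const_mul_mem_fields ho hoT _) (fun η hη => ?_) hstat
  have h := (hasDerivAt_interaction μ hρ simplicialPattern_injective (hsmooth hφ)
    (hsmooth hη)).const_mul (l : ℂ)
  simp only [← alternating_add_mul] at h
  have hpair := pairing_alternating μ (η ())
    (omitIntegral μ simplicialPattern (alternating (φ ())) 0)
  rw [← omitIntegral_alternating] at hpair
  rwa [hpair, mul_add, ← Complex.conj_ofReal l, ← map_mul, Complex.conj_ofReal] at h

end Alternating

/-! ## The Barrett–Crane model -/

section BarrettCrane

variable {G : Type*} [Group G]

theorem bcMap_one_bcMap (h : Bool → G) (u u' : Fin 4 → G) (x : BCSlot → G) :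
    bcMap 1 u (bcMap h u' x) =
      bcMap h 1 (bcMap 1 (fun j => u' j * h true * u j * (h true)⁻¹) x) := by
  funext A
  obtain ⟨j, _ | _⟩ | _ := A <;>
    simp only [bcMap, Sum.elim_inl, Sum.elim_inr, Pi.one_apply] <;> group

variable [TopologicalSpace G] {N : ℕ} {ρ : G →* Matrix (Fin N) (Fin N) ℂ} {w : (BCSlot → G) → ℂ}

theorem continuous_bcMap_one [IsTopologicalGroup G] :
    Continuous fun p : (BCSlot → G) × (Fin 4 → G) => bcMap 1 p.2 p.1 := by
  refine continuous_pi fun A => ?_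
  obtain ⟨j, _ | _⟩ | _ := A <;> simp only [bcMap, Sum.elim_inl, Sum.elim_inr] <;> fun_prop

variable [CompactSpace G]

theorem smoothAlong_comp_bcMap_one (hρ : Continuous ρ) (hw : IsSmooth ρ w) :
    SmoothAlong (Prod.map (matEmb ρ) (matEmb ρ))
      fun p : (BCSlot → G) × (Fin 4 → G) => w (bcMap 1 p.2 p.1) := by
  have hx (A : BCSlot) : SmoothGroup ρ (Prod.map (matEmb ρ) (matEmb ρ))
      fun p : (BCSlot → G) × (Fin 4 → G) => p.1 A :=
    fun i j => (smoothGroup_apply ρ A i j).comp_fst _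
  have hu (j : Fin 4) : SmoothGroup ρ (Prod.map (matEmb ρ) (matEmb ρ))
      fun p : (BCSlot → G) × (Fin 4 → G) => p.2 j :=
    fun i k => (smoothGroup_apply ρ j i k).comp_snd _
  refine hw.comp_smoothGroup fun A => ?_
  obtain ⟨j, _ | _⟩ | _ := A
  · exact ((hx _).mul (((hx _).mul (hu j)).mul ((hx _).inv hρ))).mul (.const _ _)
  · exact ((hx _).mul (hu j)).mul (.const _ _)
  · exact ((SmoothGroup.const _ _).mul (hx _)).mul (.const _ _)

variable [MeasurableSpace G] [BorelSpace G] (μ : Measure G) [IsProbabilityMeasure μ]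

theorem isSmooth_simplicityAverage [SecondCountableTopology G] (hρ : Continuous ρ)
    (hw : IsSmooth ρ w) : IsSmooth ρ (simplicityAverage μ w) :=
  SmoothAlong.integral (continuous_matEmb hρ) (smoothAlong_comp_bcMap_one hρ hw)

variable [IsTopologicalGroup G] [μ.IsHaarMeasure]

theorem simplicityAverage_comp_of_mem_bcMaps (hw : ∀ h x, w (bcMap h 1 x) = w x)
    {T : (BCSlot → G) → (BCSlot → G)} (hT : T ∈ bcMaps G) :
    simplicityAverage μ w ∘ T = simplicityAverage μ w := by
  obtain ⟨h, u', rfl⟩ := hT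
  funext x
  simp only [simplicityAverage, Function.comp_apply, bcMap_one_bcMap, hw]
  exact integral_comp_mul_mul μ (fun j => u' j * h true) (fun _ => (h true)⁻¹)
    fun u => w (bcMap 1 u x)

theorem omitIntegral_bc_bcMap (hw : ∀ T ∈ bcMaps G, w ∘ T = w) (h : Bool → G) (x : BCSlot → G) :
    omitIntegral μ bcPattern (fun _ => w) 0 (bcMap h 1 x) =
      omitIntegral μ bcPattern (fun _ => w) 0 x := by
  let p : (Fin 10 × Bool) ⊕ Fin 5 → G := Sum.elim (fun _ => 1) fun _ => (h false)⁻¹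
  let q : (Fin 10 × Bool) ⊕ Fin 5 → G := Sum.elim (fun e => h e.2) fun _ => h true
  have hpq (v y) : (fun A => p (bcPattern v A) * y A * q (bcPattern v A)) = bcMap h 1 y := by
    funext A
    obtain ⟨j, _ | _⟩ | _ := A <;> simp [bcPattern, bcMap, p, q]
  have hinv := omitIntegral_mul_mul μ p q (f := bcPattern) (ψ := fun _ => w)
    (fun v y => by rw [hpq]; exact congrFun (hw _ ⟨h, 1, rfl⟩) y) (bcPattern_injective 0) x
  rwa [hpq] at hinv

variable [SecondCountableTopology G]

theorem measurePreserving_bcMap_one (u : Fin 4 → G) :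
    MeasurePreserving (bcMap 1 u : (BCSlot → G) → _) (Measure.pi fun _ => μ)
      (Measure.pi fun _ => μ) := by
  let q (k : Unit → G) (A : Fin 4 × Bool) : G :=
    if A.2 then u A.1 else k () * u A.1 * (k ())⁻¹
  have hsplit := measurePreserving_sumPiEquivProdPi (X := fun _ : BCSlot => G) fun _ => μ
  have hmeas : Measurable (Function.uncurry fun (k : Unit → G) (g : Fin 4 × Bool → G) A =>
      1 * g A * q k A) := by
    refine measurable_pi_lambda _ fun A => ?_
    obtain ⟨j, _ | _⟩ := A <;> simp only [q, Function.uncurry, Bool.false_eq_true, if_false,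
      if_true] <;> fun_prop
  -- For fixed normal `k`, the `Spin(4)` slots undergo a right translation.
  have hskew := (MeasurePreserving.id (Measure.pi fun _ : Unit => μ)).skew_product hmeas <|
    .of_forall fun k => (measurePreserving_mul_mul μ (fun _ => 1) (q k)).map_eq
  convert hsplit.symm.comp (Measure.measurePreserving_swap.comp
    (hskew.comp (Measure.measurePreserving_swap.comp hsplit))) using 1
  funext x A
  obtain ⟨j, _ | _⟩ | _ := A <;>
    simp [bcMap, q, MeasurableEquiv.sumPiEquivProdPi, Equiv.sumPiEquivProdPi]

theorem integral_mul_simplicityAverage (hρ : Continuous ρ) {η : (BCSlot → G) → ℂ}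
    (hη : IsSmooth ρ η) (hηT : ∀ T ∈ bcMaps G, η ∘ T = η) (hw : IsSmooth ρ w) :
    ∫ x, η x * simplicityAverage μ w x ∂Measure.pi (fun _ => μ) =
      ∫ x, η x * w x ∂Measure.pi (fun _ => μ) := by
  have hcont : Continuous fun p : (BCSlot → G) × (Fin 4 → G) => η p.1 * w (bcMap 1 p.2 p.1) :=
    ((hη.continuous hρ).comp continuous_fst).mul ((hw.continuous hρ).comp continuous_bcMap_one)
  have hslice (u : Fin 4 → G) : ∫ x, η x * w (bcMap 1 u x) ∂Measure.pi (fun _ => μ) =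
      ∫ x, η x * w x ∂Measure.pi (fun _ => μ) := by
    rw [← integral_comp_of_measurePreserving (u := fun x => η x * w x)
      (measurePreserving_bcMap_one μ u) ((hη.continuous hρ).mul (hw.continuous hρ))]
    exact integral_congr_ae (.of_forall fun x =>
      congrArg (· * _) (congrFun (hηT _ ⟨1, u, rfl⟩) x).symm)
  simp only [simplicityAverage, ← integral_const_mul]
  rw [integral_integral_swap (integrable_of_continuous hcont)]
  simp [hslice]

variable {d : ℕ} {Q : InvariantMetric ρ d} {κ m l : ℝ}

theorem solvesFieldEquation_bc (hρ : Continuous ρ) {φ : Unit → (BCSlot → G) → ℂ}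
    (hφ : φ ∈ fields ρ Unit (bcMaps G))
    (hstat : IsStationary (action μ Q (bcCoupling κ 0) m l bcPattern fun _ => ())
      (fields ρ Unit (bcMaps G)) φ) :
    SolvesFieldEquation Q (bcCoupling κ 0) m l φ fun _ x =>
      (5 : ℝ) * simplicityAverage μ (omitIntegral μ bcPattern (fun _ => φ ()) 0) x := by
  have ho : IsSmooth ρ (omitIntegral μ bcPattern (fun _ => φ ()) 0) :=
    isSmooth_omitIntegral μ hρ (fun _ => (hφ ()).1) (bcPattern_injective 0)
  have hgrad := interactionGradient_unit_of_forall_eq μ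
    (omitIntegral_eq_zero_of_succ μ bcPattern_succ bcPattern_injective (φ ()))
  refine solvesFieldEquation_of_isStationary_action μ hρ bcPattern_injective
    (fun T => isFrameIsometry_of_mem_bcMaps κ) hφ
    (const_mul_mem_fields (isSmooth_simplicityAverage μ hρ ho)
      (fun T => simplicityAverage_comp_of_mem_bcMaps μ (omitIntegral_bc_bcMap μ (hφ ()).2)) _)
    (fun η hη => ?_) hstat
  rw [hgrad]
  simp [pairing, mul_left_comm _ (5 : ℂ), integral_const_mul,
    integral_mul_simplicityAverage μ hρ (hη ()).1 (hη ()).2 ho]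

end BarrettCrane

end GFT

end

open GFT in
theorem mainTheorem6_general
    {G : Type*} [Group G] [TopologicalSpace G] [IsTopologicalGroup G] [CompactSpace G]
    [MeasurableSpace G] [BorelSpace G]
    (μ : Measure G) [μ.IsHaarMeasure] [IsProbabilityMeasure μ]
    {N d : ℕ} (ρ : G →* Matrix (Fin N) (Fin N) ℂ) (hρ : Continuous ρ)
    (hρ_inj : Function.Injective ρ) (Q : InvariantMetric ρ d) (κ m l : ℝ) :
    (∀ 𝒯 ⊆ gaugeMaps G (Fin 3), ∀ φ ∈ fields ρ (Fin 4) 𝒯,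
      IsStationary (action μ Q (fun _ => κ) m l coloredPattern id) (fields ρ (Fin 4) 𝒯) φ →
        (∀ (α β : Fin 3 → OneParam ρ) (x : Fin 3 → G),
          divergence Q (current Q (fun _ => κ) m φ (biFlow α β) 0) x =
            ((-2 * l * ∑ c, (lieDeriv (biFlow α β) (φ c) x *
              omitIntegral μ coloredPattern φ c x).re : ℝ) : ℂ)) ∧
        (∀ (θ : Fin 4 → ℝ) (x : Fin 3 → G),
          divergence Q (current Q (fun _ => κ) m φ trivialFlow θ) x =
            ((-2 * l * ∑ c, θ c * (φ c x * omitIntegral μ coloredPattern φ c x).im : ℝ) : ℂ))) ∧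
    (∀ 𝒯 ⊆ gaugeMaps G (Fin 3), ∀ φ ∈ fields ρ Unit 𝒯,
      IsStationary (action μ Q (fun _ => κ) m l simplicialPattern fun _ => ())
        (fields ρ Unit 𝒯) φ →
      ∀ (α β : Fin 3 → OneParam ρ) (x : Fin 3 → G),
        divergence Q (current Q (fun _ => κ) m φ (biFlow α β) 0) x =
          ((-8 * l * (lieDeriv (biFlow α β) (φ ()) x *
            omitIntegral μ simplicialPattern (fun _ => φ ()) 0 x).re : ℝ) : ℂ)) ∧
    (∀ 𝒯, cyclicMaps G ⊆ 𝒯 → 𝒯 ⊆ cyclicMaps G ∪ gaugeMaps G (Fin 3) →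
      ∀ φ ∈ fields ρ Unit 𝒯,
        (IsStationary (action μ Q (fun _ => κ) m l boulatovPattern fun _ => ())
          (fields ρ Unit 𝒯) φ →
        ∀ (α β : Fin 3 → OneParam ρ) (x : Fin 3 → G),
          divergence Q (current Q (fun _ => κ) m φ (biFlow α β) 0) x =
            ((-8 * l * (lieDeriv (biFlow α β) (φ ()) x *
              omitIntegral μ boulatovPattern (fun _ => φ ()) 0 x).re : ℝ) : ℂ)) ∧
        (IsStationary (action μ Q (fun _ => κ) m l boulatovPattern' fun _ => ())
          (fields ρ Unit 𝒯) φ →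
        ∀ (α β : Fin 3 → OneParam ρ) (x : Fin 3 → G),
          divergence Q (current Q (fun _ => κ) m φ (biFlow α β) 0) x =
            ((-2 * l * (lieDeriv (biFlow α β) (φ ()) x * cyclicAverage (fun y => ∑ v,
              omitIntegral μ boulatovPattern' (fun _ => φ ()) v y) x).re : ℝ) : ℂ))) ∧
    (∀ 𝒯 ⊆ gaugeMaps G (Fin 3), ∀ φ ∈ fields ρ Unit 𝒯,
      IsStationary (alternatingAction μ Q (fun _ => κ) m l simplicialPattern)
        (fields ρ Unit 𝒯) φ →
        (∀ (α β : Fin 3 → OneParam ρ) (x : Fin 3 → G),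
          divergence Q (current Q (fun _ => κ) m φ (biFlow α β) 0) x =
            ((-4 * l * (lieDeriv (biFlow α β) (φ ()) x *
              omitIntegral μ simplicialPattern (alternating (φ ())) 0 x).re : ℝ) : ℂ)) ∧
        (∀ (θ : ℝ) (x : Fin 3 → G),
          divergence Q (current Q (fun _ => κ) m φ trivialFlow fun _ => θ) x =
            ((-4 * l * θ * (φ () x *
              omitIntegral μ simplicialPattern (alternating (φ ())) 0 x).im : ℝ) : ℂ))) ∧
    (∀ 𝒯 ⊆ gaugeMaps G (Fin 4), ∀ φ ∈ fields ρ Unit 𝒯,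
      IsStationary (action μ Q (fun _ => κ) m l ooguriPattern fun _ => ())
        (fields ρ Unit 𝒯) φ →
      ∀ (α β : Fin 4 → OneParam ρ) (x : Fin 4 → G),
        divergence Q (current Q (fun _ => κ) m φ (biFlow α β) 0) x =
          ((-10 * l * (lieDeriv (biFlow α β) (φ ()) x *
            omitIntegral μ ooguriPattern (fun _ => φ ()) 0 x).re : ℝ) : ℂ)) ∧
    (∀ φ ∈ fields ρ Unit (∅ : Set ((BCSlot → G) → (BCSlot → G))), ∀ κ' : ℝ,
      IsStationary (action μ Q (bcCoupling κ κ') m l bcPattern fun _ => ())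
        (fields ρ Unit ∅) φ →
      ∀ (α β : BCSlot → OneParam ρ) (x : BCSlot → G),
        divergence Q (current Q (bcCoupling κ κ') m φ (biFlow α β) 0) x =
          ((-10 * l * (lieDeriv (biFlow α β) (φ ()) x *
            omitIntegral μ bcPattern (fun _ => φ ()) 0 x).re : ℝ) : ℂ)) ∧
    (∀ φ ∈ fields ρ Unit (bcMaps G),
      IsStationary (action μ Q (bcCoupling κ 0) m l bcPattern fun _ => ())
        (fields ρ Unit (bcMaps G)) φ →
      ∀ (α β : BCSlot → OneParam ρ) (x : BCSlot → G),
        divergence Q (current Q (bcCoupling κ 0) m φ (biFlow α β) 0) x =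
          ((-10 * l * (lieDeriv (biFlow α β) (φ ()) x * simplicityAverage μ
            (omitIntegral μ bcPattern (fun _ => φ ()) 0) x).re : ℝ) : ℂ)) ∧
    (∀ {C : Type} [Fintype C] (φ : C → (Fin 3 → G) → ℂ) (θ : C → ℝ),
      current Q (fun _ => 0) m φ trivialFlow θ = 0) := by
  have := secondCountableTopology_of_injective hρ hρ_inj
  refine ⟨fun 𝒯 h𝒯 φ hφ hstat => ?_, fun 𝒯 h𝒯 φ hφ hstat α β x => ?_,
    fun 𝒯 hcyc h𝒯 φ hφ => ⟨fun hstat α β x => ?_, fun hstat α β x => ?_⟩,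
    fun 𝒯 h𝒯 φ hφ hstat => ⟨fun α β x => ?_, fun θ x => ?_⟩,
    fun 𝒯 h𝒯 φ hφ hstat α β x => ?_, fun φ hφ κ' hstat α β x => ?_,
    fun φ hφ hstat α β x => ?_, fun φ θ => current_zero_trivialFlow Q m φ θ⟩
  · have h := solvesFieldEquation_colored μ hρ h𝒯 hφ hstat
    exact ⟨h.divergence_current_flow fun c => (hφ c).1,
      h.divergence_current_phase fun c => (hφ c).1⟩
  · rw [(solvesFieldEquation_of_succ μ hρ simplicialPattern_succ simplicialPattern_injective h𝒯 hφ
      hstat).divergence_current_flow_unit (hφ ()).1]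
    norm_num
  · rw [(solvesFieldEquation_boulatov μ hρ hcyc h𝒯 hφ hstat).divergence_current_flow_unit
      (hφ ()).1]
    norm_num
  · rw [(solvesFieldEquation_boulatov' μ hρ hcyc h𝒯 hφ hstat).divergence_current_flow
      fun c => (hφ c).1, Fintype.sum_unique]
  · rw [(solvesFieldEquation_alternating μ hρ h𝒯 hφ hstat).divergence_current_flow_unit (hφ ()).1]
    norm_num
  · rw [(solvesFieldEquation_alternating μ hρ h𝒯 hφ hstat).divergence_current_phase_unit (hφ ()).1]
    norm_num
  · rw [(solvesFieldEquation_of_succ μ hρ ooguriPattern_succ ooguriPattern_injective h𝒯 hφ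
      hstat).divergence_current_flow_unit (hφ ()).1]
    norm_num
  · rw [(solvesFieldEquation_of_succ μ hρ bcPattern_succ bcPattern_injective (Set.empty_subset _)
      hφ hstat).divergence_current_flow_unit (hφ ()).1]
    norm_num
  · rw [(solvesFieldEquation_bc μ hρ hφ hstat).divergence_current_flow_unit (hφ ()).1]
    norm_num

open GFT in
theorem mainTheorem6
    {G : Type*} [Group G] [TopologicalSpace G] [IsTopologicalGroup G] [CompactSpace G]
    [MeasurableSpace G] [BorelSpace G]
    (μ : Measure G) [μ.IsHaarMeasure] [IsProbabilityMeasure μ]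
    {N d : ℕ} (ρ : G →* Matrix (Fin N) (Fin N) ℂ) (hρ : Continuous ρ)
    (hρ_inj : Function.Injective ρ) (Q : InvariantMetric ρ d) (κ m l : ℝ) :
    -- colored simplicial model `φ¹_{1,2,3} φ²_{1,4,5} φ³_{6,2,5} φ⁴_{6,4,3}`
    (∀ 𝒯 : Set ((Fin 3 → G) → (Fin 3 → G)), 𝒯 = ∅ ∨ 𝒯 = gaugeMaps G (Fin 3) →
      ∀ φ ∈ fields ρ (Fin 4) 𝒯,
      IsStationary (action μ Q (fun _ => κ) m l coloredPattern id) (fields ρ (Fin 4) 𝒯) φ →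
        (∀ (γ : Fin 3 → OneParam ρ) (x : Fin 3 → G),
          divergence Q (current Q (fun _ => κ) m φ (leftFlow γ) 0) x =
            ((-2 * l * ∑ c, (lieDeriv (leftFlow γ) (φ c) x *
              omitIntegral μ coloredPattern φ c x).re : ℝ) : ℂ)) ∧
        (∀ θ : Fin 4 → ℝ, ∑ c, θ c = 0 → ∀ x : Fin 3 → G,
          divergence Q (current Q (fun _ => κ) m φ trivialFlow θ) x =
            ((-2 * l * ∑ c, θ c * (φ c x * omitIntegral μ coloredPattern φ c x).im : ℝ) : ℂ))) ∧
    -- simplicial model `φ_{1,2,3} φ_{3,4,5} φ_{5,2,6} φ_{6,4,1}`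
    (∀ 𝒯 : Set ((Fin 3 → G) → (Fin 3 → G)), 𝒯 = ∅ ∨ 𝒯 = gaugeMaps G (Fin 3) →
      ∀ φ ∈ fields ρ Unit 𝒯,
      IsStationary (action μ Q (fun _ => κ) m l simplicialPattern fun _ => ())
        (fields ρ Unit 𝒯) φ →
      ∀ (γ₁ γ₂ : OneParam ρ) (x : Fin 3 → G),
        divergence Q (current Q (fun _ => κ) m φ (leftFlow ![γ₁, γ₂, γ₁]) 0) x =
          ((-8 * l * (lieDeriv (leftFlow ![γ₁, γ₂, γ₁]) (φ ()) x *
            omitIntegral μ simplicialPattern (fun _ => φ ()) 0 x).re : ℝ) : ℂ)) ∧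
    -- Boulatov model `φ_{1,2,3} φ_{1,4,5} φ_{2,5,6} φ_{3,6,4}` with cyclically invariant fields
    (∀ 𝒯 : Set ((Fin 3 → G) → (Fin 3 → G)),
      𝒯 = cyclicMaps G ∨ 𝒯 = cyclicMaps G ∪ gaugeMaps G (Fin 3) →
      ∀ φ ∈ fields ρ Unit 𝒯,
        (IsStationary (action μ Q (fun _ => κ) m l boulatovPattern fun _ => ())
          (fields ρ Unit 𝒯) φ →
        ∀ (γ : OneParam ρ) (x : Fin 3 → G),
          divergence Q (current Q (fun _ => κ) m φ (leftFlow fun _ => γ) 0) x =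
            ((-8 * l * (lieDeriv (leftFlow fun _ => γ) (φ ()) x *
              omitIntegral μ boulatovPattern (fun _ => φ ()) 0 x).re : ℝ) : ℂ)) ∧
        -- the variant `φ_{1,2,3} φ_{4,3,5} φ_{5,2,6} φ_{6,4,1}`
        (IsStationary (action μ Q (fun _ => κ) m l boulatovPattern' fun _ => ())
          (fields ρ Unit 𝒯) φ →
        ∀ (γ : OneParam ρ) (x : Fin 3 → G),
          divergence Q (current Q (fun _ => κ) m φ (leftFlow fun _ => γ) 0) x =
            ((-2 * l * (lieDeriv (leftFlow fun _ => γ) (φ ()) x *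
              ((1 / 3 : ℂ) * ∑ r : Fin 3, ∑ v, omitIntegral μ boulatovPattern'
                (fun _ => φ ()) v (fun i => x (i + r)))).re : ℝ) : ℂ))) ∧
    -- the model `φ_{1,2,3} φ̄_{3,4,5} φ_{5,2,6} φ̄_{6,4,1}`
    (∀ 𝒯 : Set ((Fin 3 → G) → (Fin 3 → G)), 𝒯 = ∅ ∨ 𝒯 = gaugeMaps G (Fin 3) →
      ∀ φ ∈ fields ρ Unit 𝒯,
      IsStationary (alternatingAction μ Q (fun _ => κ) m l simplicialPattern)
        (fields ρ Unit 𝒯) φ →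
        (∀ (γ₁ γ₂ : OneParam ρ) (x : Fin 3 → G),
          divergence Q (current Q (fun _ => κ) m φ (leftFlow ![γ₁, γ₂, γ₁]) 0) x =
            ((-4 * l * (lieDeriv (leftFlow ![γ₁, γ₂, γ₁]) (φ ()) x *
              omitIntegral μ simplicialPattern (alternating (φ ())) 0 x).re : ℝ) : ℂ)) ∧
        (∀ (θ : ℝ) (x : Fin 3 → G),
          divergence Q (current Q (fun _ => κ) m φ trivialFlow fun _ => θ) x =
            ((-4 * l * θ * (φ () x *
              omitIntegral μ simplicialPattern (alternating (φ ())) 0 x).im : ℝ) : ℂ))) ∧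
    -- Ooguri model
    (∀ 𝒯 : Set ((Fin 4 → G) → (Fin 4 → G)), 𝒯 = ∅ ∨ 𝒯 = gaugeMaps G (Fin 4) →
      ∀ φ ∈ fields ρ Unit 𝒯,
      IsStationary (action μ Q (fun _ => κ) m l ooguriPattern fun _ => ())
        (fields ρ Unit 𝒯) φ →
      ∀ (γ₁ γ₂ : OneParam ρ) (x : Fin 4 → G),
        divergence Q (current Q (fun _ => κ) m φ (leftFlow ![γ₁, γ₂, γ₂, γ₁]) 0) x =
          ((-10 * l * (lieDeriv (leftFlow ![γ₁, γ₂, γ₂, γ₁]) (φ ()) x *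
            omitIntegral μ ooguriPattern (fun _ => φ ()) 0 x).re : ℝ) : ℂ)) ∧
    -- Barrett–Crane model (for `G = SU(2)`), with its two families of symmetries
    (∀ φ ∈ fields ρ Unit (bcMaps G), ∀ Φ : ℝ → (BCSlot → G) → (BCSlot → G),
      (∃ σ : Fin 2 → Bool → OneParam ρ, Φ = spinFlow σ) ∨ (∃ γ : OneParam ρ, Φ = conjFlow γ) →
        -- equations of motion from arbitrary variations of the action
        (∀ κ' : ℝ,
          IsStationary (action μ Q (bcCoupling κ κ') m l bcPattern fun _ => ())
            (fields ρ Unit ∅) φ →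
          ∀ x : BCSlot → G,
            divergence Q (current Q (bcCoupling κ κ') m φ Φ 0) x =
              ((-10 * l * (lieDeriv Φ (φ ()) x *
                omitIntegral μ bcPattern (fun _ => φ ()) 0 x).re : ℝ) : ℂ)) ∧
        -- equations of motion from variations that satisfy the constraints
        (IsStationary (action μ Q (bcCoupling κ 0) m l bcPattern fun _ => ())
            (fields ρ Unit (bcMaps G)) φ →
          ∀ x : BCSlot → G,
            divergence Q (current Q (bcCoupling κ 0) m φ Φ 0) x =
              ((-10 * l * (lieDeriv Φ (φ ()) x * simplicityAverage μ
                (omitIntegral μ bcPattern (fun _ => φ ()) 0) x).re : ℝ) : ℂ))) ∧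
    -- in static models the `U(1)` currents vanish
    ((∀ φ ∈ fields ρ (Fin 4) (∅ : Set ((Fin 3 → G) → (Fin 3 → G))), ∀ θ : Fin 4 → ℝ,
        current Q (fun _ => 0) m φ trivialFlow θ = 0) ∧
      (∀ φ ∈ fields ρ Unit (∅ : Set ((Fin 3 → G) → (Fin 3 → G))), ∀ θ : ℝ,
        current Q (fun _ => 0) m φ trivialFlow (fun _ => θ) = 0)) := by
  obtain ⟨hcolored, hsimplicial, hboulatov, halternating, hooguri, hbc, hbc_constrained, hstatic⟩ :=
    mainTheorem6_general μ ρ hρ hρ_inj Q κ m l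
  have hgauge {ι : Type} {𝒯 : Set ((ι → G) → (ι → G))} (h : 𝒯 = ∅ ∨ 𝒯 = gaugeMaps G ι) :
      𝒯 ⊆ gaugeMaps G ι := by rcases h with rfl | rfl <;> simp
  simp only [leftFlow_eq_biFlow]
  refine ⟨fun 𝒯 h𝒯 φ hφ hstat => ?_, fun 𝒯 h𝒯 φ hφ hstat _ _ =>
      hsimplicial 𝒯 (hgauge h𝒯) φ hφ hstat _ _, fun 𝒯 h𝒯 φ hφ => ?_,
    fun 𝒯 h𝒯 φ hφ hstat => ?_, fun 𝒯 h𝒯 φ hφ hstat _ _ =>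
      hooguri 𝒯 (hgauge h𝒯) φ hφ hstat _ _, fun φ hφ Φ hΦ => ?_,
    fun φ _ => hstatic φ, fun φ _ θ => hstatic φ fun _ => θ⟩
  · obtain ⟨hflow, hphase⟩ := hcolored 𝒯 (hgauge h𝒯) φ hφ hstat
    exact ⟨fun _ => hflow _ _, fun θ _ => hphase θ⟩
  · have hcyc : cyclicMaps G ⊆ 𝒯 ∧ 𝒯 ⊆ cyclicMaps G ∪ gaugeMaps G (Fin 3) := by
      rcases h𝒯 with rfl | rfl <;> simp
    obtain ⟨h, h'⟩ := hboulatov 𝒯 hcyc.1 hcyc.2 φ hφ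
    exact ⟨fun hstat _ => h hstat _ _, fun hstat _ => h' hstat _ _⟩
  · obtain ⟨hflow, hphase⟩ := halternating 𝒯 (hgauge h𝒯) φ hφ hstat
    exact ⟨fun _ _ => hflow _ _, hphase⟩
  · obtain ⟨α, β, rfl⟩ : ∃ α β : BCSlot → OneParam ρ, Φ = biFlow α β :=
      hΦ.elim (fun ⟨_, h⟩ => ⟨_, _, h.trans (leftFlow_eq_biFlow _)⟩) fun ⟨_, h⟩ => ⟨_, _, h⟩
    exact ⟨fun κ' hstat => hbc φ (fun c => ⟨(hφ c).1, by simp⟩) κ' hstat α β,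
      fun hstat => hbc_constrained φ hφ hstat α β⟩
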